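/- **Setting.** Let $d\ge 0$, $k\ge 1$, $\mathbb T^d=(\mathbb R/\mathbb Z)^d$. For functions $f_\iota$ on $\mathbb T^d$, $\iota\in\{0,1\}^k$, put $$\Delta^k(\boldsymbol f)(x;u_1,\dots,u_k)=\prod_{\iota\in\{0,1\}^k}\mathcal C^{|\iota|}f_\iota(x-\iota_1u_1-\dots-\iota_ku_k)\qquad(\mathcal C=\text{complex conjugation}),$$ so that $\Delta^k(\boldsymbol f)(x;u)=\Delta^{k-1}(\boldsymbol f_0)(x;u')\,\overline{\Delta^{k-1}(\boldsymbol f_1)(x-u_k;u')}$, where $\boldsymbol f_i$ is the half of the family with $\iota_k=i$ and $u'=(u_1,\dots,u_{k-1})$. For finite complex measures $\boldsymbol\mu=(\mu_\iota)$ on $\mathbb T^d$, $\Delta^k(\boldsymbol\mu)$ is the finite complex measure on $\mathbb T^d\times(\mathbb T^d)^k$ that is the weak limit of the densities $\Delta^k((K_n*\mu_\iota)_\iota)$ for every approximate identity $(K_n)$ (continuous, $K_n\ge0$, $\int K_n=1$, mass concentrating at $0$). Write $\Delta^k\mu$ when all $\mu_\iota=\mu$, let $\|\mu\|_{U^k}=\Delta^k\mu(\mathbb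 T^d\times(\mathbb T^d)^k)^{1/2^k}$ ($=\infty$ if $\Delta^k\mu$ does not exist), and let $U^k$ be the set of finite $\mu$ with $\||\mu|\|_{U^k}<\infty$. Let $(\phi_n)$ be an approximate identity of trigonometric polynomials with $0\le\widehat{\phi_n}\le1$, and $\phi_N^c=\delta_0-\phi_N$. For $1\le j\le k$ let $\phi_N^c\star_j$ denote convolution in the variable $u_j$ if $j<k$, and in the variable $x$ if $j=k$, for functions of $(x;u_1,\dots,u_{k-1})$. Define $\Delta^k_{s_j-\eta_j>N,\,s_j>N}(\boldsymbol\mu)$ as the same weak limit with $\Delta^k$ replaced by $$(\phi_N^c\star_j\Delta^{k-1}(\boldsymbol f_0))(x;u')\,\overline{(\phi_N^c\star_j\Delta^{k-1}(\boldsymbol f_1))(x-u_k;u')},$$ and $\Delta^k_{s_j-\eta_j>N}(\boldsymbol\mu)$ as the one with $$\Delta^{k-1}(\boldsymbol f_0)(x;u')\,\overline{(\phi_N^c\star_j\Delta^{k-1}(\boldsymbol f_1))(x-u_k;u')}.$$ **Lemma.** Let $\mu_\iota\in U^k$ for $\iota\in\{0,1\}^k$, $N\in\mathbb N$ and $1\le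 j\le k$. Then, in $[0,\infty]$, $$\sum_{\boldsymbol\eta\in(\mathbb Z^d)^k}\bigl|\widehat{\Delta^k_{s_j-\eta_j>N,\,s_j>N}(\boldsymbol\mu)}(0;\boldsymbol\eta)\bigr|^2\le16\prod_{\iota\in\{0,1\}^k}\|\mu_\iota\|_{U^{k+1}}^2,$$ $$\sum_{\boldsymbol\eta\in(\mathbb Z^d)^k}\bigl|\widehat{\Delta^k_{s_j-\eta_j>N}(\boldsymbol\mu)}(0;\boldsymbol\eta)\bigr|^2\le2\prod_{\iota\in\{0,1\}^k}\|\mu_\iota\|_{U^{k+1}}^2.$$ -/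

import Mathlib

open MeasureTheory Filter Topology
open scoped ENNReal ComplexConjugate

noncomputable section

namespace GowersSingular

/-- The torus `𝕋^d = (ℝ/ℤ)^d`; its `volume` is the Haar probability measure. -/
abbrev Torus (d : ℕ) : Type := UnitAddTorus (Fin d)

/-- The space `𝕋^d × (𝕋^d)^k` of points `(x; u) = (x; u_1, …, u_k)`. -/
abbrev Cube (d k : ℕ) : Type := Torus d × (Fin k → Torus d)

/-- The total variation of a complex measure is finite. -/
instance isFiniteMeasure_variation {X : Type*} [MeasurableSpace X] (μ : ComplexMeasure X) :
    IsFiniteMeasure μ.variation := by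
  have h : μ.variation ≤ (ComplexMeasure.re μ).totalVariation
      + (ComplexMeasure.im μ).totalVariation := by
    apply VectorMeasure.variation_le_of_forall_enorm_le
    intro s _
    have h1 : μ s = ((ComplexMeasure.re μ s : ℝ) : ℂ) + ((ComplexMeasure.im μ s : ℝ) : ℂ) *
        Complex.I := (Complex.re_add_im (μ s)).symm
    calc ‖μ s‖ₑ ≤ ‖((ComplexMeasure.re μ s : ℝ) : ℂ)‖ₑ
          + ‖((ComplexMeasure.im μ s : ℝ) : ℂ) * Complex.I‖ₑ := by
            rw [h1]; exact enorm_add_le _ _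
      _ = ‖ComplexMeasure.re μ s‖ₑ + ‖ComplexMeasure.im μ s‖ₑ := by
            simp [← ofReal_norm]
      _ ≤ _ := by
            rw [Measure.add_apply]
            exact add_le_add (SignedMeasure.enorm_le_totalVariation _ _)
              (SignedMeasure.enorm_le_totalVariation _ _)
  exact isFiniteMeasure_of_le _ h

/-- The integral `∫ f dμ` of a complex function against a complex measure. -/
def cintegral {X : Type*} [MeasurableSpace X] (μ : ComplexMeasure X) (f : X → ℂ) : ℂ :=
  μ.integral f (ContinuousLinearMap.mul ℝ ℂ)

/-- The total variation `|μ|`, again as a complex measure. -/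
def absMeasure {X : Type*} [MeasurableSpace X] (μ : ComplexMeasure X) : ComplexMeasure X :=
  μ.variation.toSignedMeasure.toComplexMeasure 0

/-- Fourier coefficients of a complex measure on `𝕋^d × (𝕋^d)^k`:
`∫ e^{-2πi (ξ·x + η_1·u_1 + ⋯ + η_k·u_k)} dD(x; u)`. -/
def fourierCoeffMeasure {d k : ℕ} (D : ComplexMeasure (Cube d k))
    (ξ : Fin d → ℤ) (η : Fin k → Fin d → ℤ) : ℂ :=
  cintegral D fun p =>
    UnitAddTorus.mFourier (-ξ) p.1 * ∏ i, UnitAddTorus.mFourier (-(η i)) (p.2 i)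

/-- Fourier coefficients of a kernel on the torus. -/
def kernelCoeff {d : ℕ} (φ : C(Torus d, ℝ)) (c : Fin d → ℤ) : ℂ :=
  ∫ x, UnitAddTorus.mFourier (-c) x * (φ x : ℂ)

/-- Approximate identities on the torus. -/
structure IsApproxIdentity {d : ℕ} (K : ℕ → C(Torus d, ℝ)) : Prop where
  nonneg : ∀ n x, 0 ≤ K n x
  integral_eq_one : ∀ n, ∫ x, K n x = 1
  concentrates : ∀ U ∈ 𝓝 (0 : Torus d), Tendsto (fun n => ∫ x in Uᶜ, K n x) atTop (𝓝 0)

/-- The approximate identities used for frequency truncation: each `φ_n` is a trigonometric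
polynomial, and its Fourier transform is a cutoff with values in `[0, 1]`. -/
structure IsFrequencyCutoff {d : ℕ} (φ : ℕ → C(Torus d, ℝ)) : Prop
    extends IsApproxIdentity φ where
  finite_support : ∀ n, {c | kernelCoeff (φ n) c ≠ 0}.Finite
  coeff_mem : ∀ n c, ∃ r ∈ Set.Icc (0 : ℝ) 1, kernelCoeff (φ n) c = r

/-- The convolution `K ∗ μ`. -/
def mollify {d : ℕ} (K : C(Torus d, ℝ)) (μ : ComplexMeasure (Torus d)) : Torus d → ℂ :=
  fun x => cintegral μ fun y => (K (x - y) : ℂ)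

/-- For functions `A`, `B` of `(x; u_1, …, u_k)`, the function
`A(x; u_1, …, u_k) * conj (B(x - u_{k+1}; u_1, …, u_k))` of `(x; u_1, …, u_{k+1})`. -/
def cross {d k : ℕ} (A B : Cube d k → ℂ) : Cube d (k + 1) → ℂ :=
  fun p => A (p.1, Fin.init p.2) * conj (B (p.1 - p.2 (Fin.last k), Fin.init p.2))

/-- The half `(f_{ι' i})_{ι'}` of a family indexed by `{0,1}^{k+1}`, for `i` a value of the
coordinate of the index that belongs to `u_{k+1}`. -/
def half {k : ℕ} {α : Type*} (f : (Fin (k + 1) → Bool) → α) (i : Bool) : (Fin k → Bool) → α :=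
  fun ι => f (Fin.snoc ι i)

/-- `Δ^k` of a family of functions: `∏_ι 𝒞^{|ι|} f_ι (x - ι·u)`, where `𝒞` is complex
conjugation, written through `Δ^{k+1} f = cross (Δ^k f_0) (Δ^k f_1)`. -/
def deltaFun {d : ℕ} : (k : ℕ) → ((Fin k → Bool) → Torus d → ℂ) → Cube d k → ℂ
  | 0, f => fun p => f Fin.elim0 p.1
  | k + 1, f => cross (deltaFun k (half f false)) (deltaFun k (half f true))

/-- Convolution with `φ` in the variable `u_j` when `j ≤ k`, and in the variable `x` for the
last index `j = k + 1`. -/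
def partialConv {d k : ℕ} (φ : C(Torus d, ℝ)) (j : Fin (k + 1)) (G : Cube d k → ℂ) :
    Cube d k → ℂ :=
  Fin.lastCases (motive := fun _ => Cube d k → ℂ)
    (fun p => ∫ y, (φ y : ℂ) * G (p.1 - y, p.2))
    (fun i p => ∫ y, (φ y : ℂ) * G (p.1, Function.update p.2 i (p.2 i - y)))
    j

/-- Partial convolution with `φ^c = δ_0 - φ`, whose Fourier transform is `1 - φ̂`. -/
def highPass {d k : ℕ} (φ : C(Torus d, ℝ)) (j : Fin (k + 1)) (G : Cube d k → ℂ) :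
    Cube d k → ℂ :=
  fun p => G p - partialConv φ j G p

/-- `Δ^{k+1}_{s_j - η_j > N, s_j > N}` of a family of functions, with `φ = φ_N`. -/
def deltaFunHighBoth {d k : ℕ} (φ : C(Torus d, ℝ)) (j : Fin (k + 1))
    (f : (Fin (k + 1) → Bool) → Torus d → ℂ) : Cube d (k + 1) → ℂ :=
  cross (highPass φ j (deltaFun k (half f false))) (highPass φ j (deltaFun k (half f true)))

/-- `Δ^{k+1}_{s_j - η_j > N}` of a family of functions, with `φ = φ_N`. -/
def deltaFunHighRight {d k : ℕ} (φ : C(Torus d, ℝ)) (j : Fin (k + 1))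
    (f : (Fin (k + 1) → Bool) → Torus d → ℂ) : Cube d (k + 1) → ℂ :=
  cross (deltaFun k (half f false)) (highPass φ j (deltaFun k (half f true)))

/-- `D` is the value of the operation `G` on functions at a family `μ` of complex measures: for
every approximate identity `K_n`, the measures with density `G ((K_n ∗ μ_ι)_ι)` converge weakly
to `D`. -/
def IsWeakValue {d k : ℕ} (G : ((Fin k → Bool) → Torus d → ℂ) → Cube d k → ℂ)
    (μ : (Fin k → Bool) → ComplexMeasure (Torus d)) (D : ComplexMeasure (Cube d k)) : Prop :=
  ∀ K : ℕ → C(Torus d, ℝ), IsApproxIdentity K → ∀ F : C(Cube d k, ℂ),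
    Tendsto (fun n => ∫ p, F p * G (fun ι => mollify (K n) (μ ι)) p) atTop
      (𝓝 (cintegral D F))

open Classical in
/-- The measure determined by `IsWeakValue` (and `0` where there is none). -/
def weakValue {d k : ℕ} (G : ((Fin k → Bool) → Torus d → ℂ) → Cube d k → ℂ)
    (μ : (Fin k → Bool) → ComplexMeasure (Torus d)) : ComplexMeasure (Cube d k) :=
  if h : ∃ D, IsWeakValue G μ D then h.choose else 0

/-- The measure `Δ^{k+1}_{s_j - η_j > N, s_j > N}(μ)`, where `φ = φ_N`. -/
def deltaHighBoth {d k : ℕ} (φ : C(Torus d, ℝ)) (j : Fin (k + 1))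
    (μ : (Fin (k + 1) → Bool) → ComplexMeasure (Torus d)) : ComplexMeasure (Cube d (k + 1)) :=
  weakValue (deltaFunHighBoth φ j) μ

/-- The measure `Δ^{k+1}_{s_j - η_j > N}(μ)`, where `φ = φ_N`. -/
def deltaHighRight {d k : ℕ} (φ : C(Torus d, ℝ)) (j : Fin (k + 1))
    (μ : (Fin (k + 1) → Bool) → ComplexMeasure (Torus d)) : ComplexMeasure (Cube d (k + 1)) :=
  weakValue (deltaFunHighRight φ j) μ

open Classical in
/-- The uniformity norm `‖μ‖_{U^k} = Δ^kμ(𝕋^d × (𝕋^d)^k)^{1/2^k}`, where `Δ^kμ` is `Δ^k` of the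
constant family `μ`; it is infinite when `Δ^kμ` does not exist. -/
def uNorm {d : ℕ} (k : ℕ) (μ : ComplexMeasure (Torus d)) : ℝ≥0∞ :=
  if ∃ D, IsWeakValue (deltaFun k) (fun _ => μ) D then
    ‖weakValue (deltaFun k) (fun _ => μ) Set.univ‖ₑ ^ ((1 : ℝ) / 2 ^ k)
  else ⊤

/-- The space `U^k` of complex measures `μ` with `‖|μ|‖_{U^k} < ∞`. -/
def MemU {d : ℕ} (k : ℕ) (μ : ComplexMeasure (Torus d)) : Prop :=
  uNorm k (absMeasure μ) < ⊤

end GowersSingular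

/-!
Put `A = Δ^k f_0`, `B = Δ^k f_1` and let `Â(c; u)` be the Fourier coefficients of `A(·; u)`.
Integrating `cross A B` over `x` gives a correlation in `u_{k+1}`, so by Parseval the square
integral of this marginal is the energy `∫ ∑_c |Â(c; u)|² |B̂(c; u)|² du`, and by Bessel it bounds
the Fourier sum of `cross A B`. By the Cauchy–Schwarz and Gowers–Cauchy–Schwarz inequalities the
energy is at most the product of the squares of the `U^{k+2}` norms of the `f_ι`.

Convolution with `φ^c = δ_0 - φ` contracts `L²` because `|1 - φ̂| ≤ 1`, and has norm at most `2` on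
`L^∞`; interpolating, it multiplies `∫ |·|⁴` by at most `4`. The energy of `A` with itself is
`∑_c ∫ |Â(c; u)|⁴ du`, so truncating `A` multiplies it by at most `4`, and by Cauchy–Schwarz each
truncated factor costs a factor `2` in the bound.

The bounds pass to the weak limit along an approximate identity. The only delicate case is a product
of norms of the form `0 · ∞`; there `|μ̂(ξ)| ≤ ‖μ‖_{U^{k+2}}` shows that some `μ_ι` vanishes,
and with it the bounds before the limit.
-/

namespace GowersSingular

theorem haarAddCircle_eq_volume :
    (AddCircle.haarAddCircle : Measure UnitAddCircle) = volume := by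
  rw [AddCircle.volume_eq_smul_haarAddCircle, ENNReal.ofReal_one, one_smul]

instance : IsProbabilityMeasure (volume : Measure UnitAddCircle) := by
  rw [← haarAddCircle_eq_volume]; infer_instance

section Torus

variable {d : ℕ}

instance : IsProbabilityMeasure (volume : Measure (Torus d)) :=
  inferInstanceAs (IsProbabilityMeasure
    (Measure.pi fun _ : Fin d => (volume : Measure UnitAddCircle)))

instance : (volume : Measure (Torus d)).IsAddLeftInvariant :=
  Measure.pi.isAddLeftInvariant (ι := Fin d) (α := fun _ => UnitAddCircle) _

instance : (volume : Measure (Torus d)).IsNegInvariant :=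
  Measure.pi.isNegInvariant (ι := Fin d) (α := fun _ => UnitAddCircle) _

instance : SecondCountableTopology (Torus d) :=
  inferInstanceAs (SecondCountableTopology (Fin d → UnitAddCircle))

end Torus

/-- Bounded measurable complex functions. They are closed under every operation used here and are
integrable against finite measures. -/
structure IsBdd {X : Type*} [MeasurableSpace X] (f : X → ℂ) : Prop where
  measurable : Measurable f
  exists_norm_le : ∃ C : ℝ, ∀ x, ‖f x‖ ≤ C

namespace IsBdd

variable {X Y : Type*} [MeasurableSpace X] [MeasurableSpace Y] {f g : X → ℂ}

theorem of_continuous [TopologicalSpace X] [CompactSpace X] [BorelSpace X] (hf : Continuous f) :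
    IsBdd f := by
  obtain ⟨C, hC⟩ := (isCompact_range hf).isBounded.exists_norm_le
  exact ⟨hf.measurable, C, fun x => hC _ ⟨x, rfl⟩⟩

theorem mul (hf : IsBdd f) (hg : IsBdd g) : IsBdd (fun x => f x * g x) := by
  obtain ⟨hf, C, hC⟩ := hf
  obtain ⟨hg, D, hD⟩ := hg
  refine ⟨hf.mul hg, C * D, fun x => ?_⟩
  rw [norm_mul]
  exact mul_le_mul (hC x) (hD x) (norm_nonneg _) ((norm_nonneg _).trans (hC x))

theorem star (hf : IsBdd f) : IsBdd (fun x => conj (f x)) := by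
  obtain ⟨hf, C, hC⟩ := hf
  exact ⟨Complex.continuous_conj.measurable.comp hf, C, fun x => by simpa using hC x⟩

theorem comp (hf : IsBdd f) {e : Y → X} (he : Measurable e) : IsBdd (fun y => f (e y)) := by
  obtain ⟨hf, C, hC⟩ := hf
  exact ⟨hf.comp he, C, fun y => hC _⟩

theorem integrable (hf : IsBdd f) (m : Measure X) [IsFiniteMeasure m] : Integrable f m := by
  obtain ⟨hf, C, hC⟩ := hf
  exact Integrable.of_bound hf.aestronglyMeasurable C (Eventually.of_forall hC)

theorem memLp (hf : IsBdd f) (m : Measure X) [IsFiniteMeasure m] (p : ℝ≥0∞) : MemLp f p m := by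
  obtain ⟨hf, C, hC⟩ := hf
  exact MemLp.of_bound hf.aestronglyMeasurable C (Eventually.of_forall hC)

theorem integral {F : X × Y → ℂ} (hF : IsBdd F) (m : Measure Y) [IsFiniteMeasure m] :
    IsBdd (fun x => ∫ y, F (x, y) ∂m) := by
  obtain ⟨hF, C, hC⟩ := hF
  exact ⟨(hF.stronglyMeasurable.integral_prod_right' (ν := m)).measurable, C * m.real Set.univ,
    fun x => norm_integral_le_of_norm_le_const (Eventually.of_forall fun y => hC (x, y))⟩

theorem integral_integral_swap {m : Measure X} {n : Measure Y} [IsFiniteMeasure m]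
    [IsFiniteMeasure n] {F : X → Y → ℂ} (hF : IsBdd (fun p : X × Y => F p.1 p.2)) :
    ∫ x, ∫ y, F x y ∂n ∂m = ∫ y, ∫ x, F x y ∂m ∂n :=
  MeasureTheory.integral_integral_swap (hF.integrable _)

theorem ofReal_integral_norm_pow (hf : IsBdd f) (m : Measure X) [IsFiniteMeasure m] {n : ℕ}
    (hn : n ≠ 0) : ENNReal.ofReal (∫ x, ‖f x‖ ^ n ∂m) = ∫⁻ x, ‖f x‖ₑ ^ n ∂m := by
  rw [ofReal_integral_eq_lintegral_ofReal ((hf.memLp m n).integrable_norm_pow hn)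
    (Eventually.of_forall fun _ => by positivity)]
  simp only [ENNReal.ofReal_pow (norm_nonneg _), ofReal_norm]

theorem lintegral_enorm_pow_ne_top (hf : IsBdd f) (m : Measure X) [IsFiniteMeasure m] {n : ℕ}
    (hn : n ≠ 0) : ∫⁻ x, ‖f x‖ₑ ^ n ∂m ≠ ∞ := by
  rw [← hf.ofReal_integral_norm_pow m hn]
  exact ENNReal.ofReal_ne_top

end IsBdd

section CauchySchwarz

variable {X : Type*} [MeasurableSpace X] {m : Measure X}

theorem sq_lintegral_mul_le {f g : X → ℝ≥0∞} (hf : AEMeasurable f m) (hg : AEMeasurable g m) :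
    (∫⁻ x, f x * g x ∂m) ^ 2 ≤ (∫⁻ x, f x ^ 2 ∂m) * ∫⁻ x, g x ^ 2 ∂m := by
  have sq_sqrt (t : ℝ≥0∞) : (t ^ (1 / 2 : ℝ)) ^ 2 = t := by
    rw [← ENNReal.rpow_natCast, ← ENNReal.rpow_mul]; norm_num
  have h := ENNReal.lintegral_mul_le_Lp_mul_Lq m Real.HolderConjugate.two_two hf hg
  simp only [Pi.mul_apply, ENNReal.rpow_two] at h
  refine (pow_le_pow_left' h 2).trans_eq ?_
  rw [mul_pow, sq_sqrt, sq_sqrt]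

theorem enorm_integral_mul_sq_le {f g : X → ℂ} (hf : AEMeasurable f m) (hg : AEMeasurable g m) :
    ‖∫ x, f x * g x ∂m‖ₑ ^ 2 ≤ (∫⁻ x, ‖f x‖ₑ ^ 2 ∂m) * ∫⁻ x, ‖g x‖ₑ ^ 2 ∂m :=
  calc ‖∫ x, f x * g x ∂m‖ₑ ^ 2 ≤ (∫⁻ x, ‖f x‖ₑ * ‖g x‖ₑ ∂m) ^ 2 :=
        pow_le_pow_left' ((enorm_integral_le_lintegral_enorm _).trans_eq
          (by simp only [enorm_mul])) 2
    _ ≤ _ := sq_lintegral_mul_le hf.enorm hg.enorm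

end CauchySchwarz

section Fourier

open UnitAddTorus

variable {d : ℕ}

theorem isBdd_mFourier (c : Fin d → ℤ) : IsBdd (fun x : Torus d => mFourier c x) :=
  .of_continuous (mFourier c).continuous

theorem mFourier_add_apply (c : Fin d → ℤ) (x y : Torus d) :
    mFourier c (x + y) = mFourier c x * mFourier c y := by
  simp [mFourier, Finset.prod_mul_distrib, fourier_apply, AddCircle.toCircle_add]

theorem mFourier_sub_apply (c : Fin d → ℤ) (x y : Torus d) :
    mFourier c (x - y) = mFourier c x * mFourier (-c) y := by
  rw [sub_eq_add_neg, mFourier_add_apply]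
  simp [mFourier, fourier_apply]

/-- Fourier coefficients of functions on the torus, with respect to `volume` on `ℝ/ℤ` rather than
`AddCircle.haarAddCircle`. -/
noncomputable def coeff (g : Torus d → ℂ) (c : Fin d → ℤ) : ℂ := ∫ x, mFourier (-c) x * g x

theorem pi_haarAddCircle_eq_volume :
    (Measure.pi fun _ : Fin d => (AddCircle.haarAddCircle : Measure UnitAddCircle))
      = (volume : Measure (Torus d)) := by
  simp_rw [haarAddCircle_eq_volume]; rfl

theorem mFourierCoeff_eq_coeff (g : Torus d → ℂ) (c : Fin d → ℤ) :
    mFourierCoeff g c = coeff g c := by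
  rw [coeff, ← pi_haarAddCircle_eq_volume]; rfl

theorem coeff_zero (g : Torus d → ℂ) : coeff g 0 = ∫ x, g x := by
  simp [coeff, mFourier_zero]

theorem coeff_congr_ae {g h : Torus d → ℂ} (hgh : g =ᵐ[volume] h) (c : Fin d → ℤ) :
    coeff g c = coeff h c :=
  integral_congr_ae (hgh.mono fun x hx => by simp only [hx])

theorem integral_mFourier (c : Fin d → ℤ) :
    ∫ x : Torus d, mFourier c x = if c = 0 then 1 else 0 := by
  have h := orthonormal_iff_ite.mp (orthonormal_mFourier (d := Fin d)) 0 c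
  rw [ContinuousMap.inner_toLp] at h
  rw [← pi_haarAddCircle_eq_volume]
  simpa [eq_comm, mFourier_zero] using! h

theorem hasSum_norm_coeff_sq {g : Torus d → ℂ} (hg : MemLp g 2) :
    HasSum (fun c => ‖coeff g c‖ ^ 2) (∫ x, ‖g x‖ ^ 2) := by
  have hg' : MemLp g 2 (Measure.pi fun _ : Fin d =>
      (AddCircle.haarAddCircle : Measure UnitAddCircle)) := by
    rwa [pi_haarAddCircle_eq_volume]
  have hae : hg'.toLp =ᵐ[volume] g :=
    (Measure.absolutelyContinuous_of_eq pi_haarAddCircle_eq_volume.symm).ae_eq hg'.coeFn_toLp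
  have h := hasSum_sq_mFourierCoeff (d := Fin d) hg'.toLp
  simp only [mFourierCoeff_eq_coeff, coeff_congr_ae hae] at h
  convert h using 1
  rw [← pi_haarAddCircle_eq_volume]
  exact integral_congr_ae (hg'.coeFn_toLp.mono fun x hx => by simp only [hx])

theorem lintegral_enorm_sq_eq_tsum_coeff {g : Torus d → ℂ} (hg : IsBdd g) :
    ∫⁻ x, ‖g x‖ₑ ^ 2 = ∑' c, ‖coeff g c‖ₑ ^ 2 := by
  have h := hasSum_norm_coeff_sq (hg.memLp volume 2)
  rw [← hg.ofReal_integral_norm_pow volume two_ne_zero, ← h.tsum_eq,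
    ENNReal.ofReal_tsum_of_nonneg (fun _ => by positivity) h.summable]
  simp only [ENNReal.ofReal_pow (norm_nonneg _), ofReal_norm]

/-- The correlation `v ↦ ∫ A(x) conj B(x - v) dx`, whose Fourier transform is `Â conj B̂`. -/
noncomputable def corr (A B : Torus d → ℂ) (v : Torus d) : ℂ := ∫ x, A x * conj (B (x - v))

theorem IsBdd.corr {A B : Torus d → ℂ} (hA : IsBdd A) (hB : IsBdd B) : IsBdd (corr A B) :=
  IsBdd.integral (F := fun p : Torus d × Torus d => A p.2 * conj (B (p.2 - p.1)))
    ((hA.comp measurable_snd).mul (hB.comp (measurable_snd.sub measurable_fst)).star) volume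

theorem coeff_corr {A B : Torus d → ℂ} (hA : IsBdd A) (hB : IsBdd B) (c : Fin d → ℤ) :
    coeff (corr A B) c = coeff A c * conj (coeff B c) := by
  have hbdd : IsBdd fun p : Torus d × Torus d =>
      mFourier (-c) p.1 * (A p.2 * conj (B (p.2 - p.1))) :=
    ((isBdd_mFourier (-c)).comp measurable_fst).mul
      ((hA.comp measurable_snd).mul (hB.comp (measurable_snd.sub measurable_fst)).star)
  have inner (x : Torus d) : ∫ v, mFourier (-c) v * (A x * conj (B (x - v)))
      = mFourier (-c) x * A x * conj (coeff B c) := by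
    rw [coeff, ← integral_sub_left_eq_self _ volume x, ← integral_conj, ← integral_const_mul]
    refine integral_congr_ae (Eventually.of_forall fun y => ?_)
    simp only [sub_sub_cancel, mFourier_sub_apply, neg_neg, map_mul, ← mFourier_neg]
    ring
  calc coeff (corr A B) c = ∫ v, ∫ x, mFourier (-c) v * (A x * conj (B (x - v))) := by
        simp only [coeff, corr, integral_const_mul]
    _ = ∫ x, ∫ v, mFourier (-c) v * (A x * conj (B (x - v))) := hbdd.integral_integral_swap
    _ = coeff A c * conj (coeff B c) := by simp only [inner, integral_mul_const, coeff]

theorem lintegral_enorm_corr_sq {A B : Torus d → ℂ} (hA : IsBdd A) (hB : IsBdd B) :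
    ∫⁻ v, ‖corr A B v‖ₑ ^ 2 = ∑' c, ‖coeff A c‖ₑ ^ 2 * ‖coeff B c‖ₑ ^ 2 := by
  rw [lintegral_enorm_sq_eq_tsum_coeff (hA.corr hB)]
  simp [coeff_corr hA hB, mul_pow]

variable {m : ℕ}

/-- The character `u ↦ e^{2πi (η_1·u_1 + ⋯ + η_m·u_m)}` of `(𝕋^d)^m`. -/
noncomputable def multiChar (η : Fin m → Fin d → ℤ) : C(Fin m → Torus d, ℂ) where
  toFun u := ∏ i, mFourier (η i) (u i)
  continuous_toFun := by fun_prop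

theorem conj_multiChar_apply (η : Fin m → Fin d → ℤ) (u : Fin m → Torus d) :
    conj (multiChar η u) = multiChar (-η) u := by
  simp [multiChar, mFourier_neg]

theorem orthonormal_multiChar : Orthonormal ℂ (fun η : Fin m → Fin d → ℤ =>
    ContinuousMap.toLp (E := ℂ) 2 (volume : Measure (Fin m → Torus d)) ℂ (multiChar η)) := by
  rw [orthonormal_iff_ite]
  intro η ξ
  have h (u : Fin m → Torus d) : multiChar ξ u * conj (multiChar η u)
      = ∏ i, mFourier (ξ i + -η i) (u i) := by
    simp only [multiChar, ContinuousMap.coe_mk, map_prod, ← Finset.prod_mul_distrib,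
      mFourier_add, mFourier_neg]
  simp only [ContinuousMap.inner_toLp, h]
  rw [volume_pi, integral_fintype_prod_eq_prod
    (f := fun i (x : Torus d) => mFourier (ξ i + -η i) x)]
  simp only [integral_mFourier, ← sub_eq_add_neg, sub_eq_zero]
  rw [Finset.prod_ite_zero]
  simp [funext_iff, eq_comm]

theorem tsum_enorm_integral_multiChar_sq_le {g : (Fin m → Torus d) → ℂ} (hg : IsBdd g) :
    ∑' η : Fin m → Fin d → ℤ, ‖∫ u, multiChar (-η) u * g u‖ₑ ^ 2 ≤ ∫⁻ u, ‖g u‖ₑ ^ 2 := by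
  have hL2 := hg.memLp (volume : Measure (Fin m → Torus d)) 2
  have inner_eq (η : Fin m → Fin d → ℤ) : inner ℂ (ContinuousMap.toLp (E := ℂ) 2
      (volume : Measure (Fin m → Torus d)) ℂ (multiChar η)) hL2.toLp
      = ∫ u, multiChar (-η) u * g u := by
    rw [L2.inner_def]
    refine integral_congr_ae ?_
    filter_upwards [hL2.coeFn_toLp, ContinuousMap.coeFn_toLp (p := 2) (𝕜 := ℂ)
      (volume : Measure (Fin m → Torus d)) (multiChar η)] with u h1 h2
    rw [h1, h2, RCLike.inner_apply, conj_multiChar_apply, mul_comm]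
  have norm_eq : ENNReal.ofReal (‖hL2.toLp‖ ^ 2) = ∫⁻ u, ‖g u‖ₑ ^ 2 := by
    rw [ENNReal.ofReal_pow (norm_nonneg _), ofReal_norm, Lp.enorm_toLp,
      eLpNorm_eq_lintegral_rpow_enorm_toReal (by norm_num) (by norm_num),
      ← ENNReal.rpow_natCast, ← ENNReal.rpow_mul]
    simp
  rw [ENNReal.tsum_eq_iSup_sum, ← norm_eq]
  refine iSup_le fun s => ?_
  refine le_trans (le_of_eq ?_)
    (ENNReal.ofReal_le_ofReal (orthonormal_multiChar.sum_inner_products_le hL2.toLp (s := s)))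
  simp only [ENNReal.ofReal_sum_of_nonneg fun _ _ => sq_nonneg _, inner_eq,
    ENNReal.ofReal_pow (norm_nonneg _), ofReal_norm]

end Fourier

section HolomorphicIntegral

open Metric

variable {Y E : Type*} [MeasurableSpace Y] {m : Measure Y} [IsFiniteMeasure m]
  [NormedAddCommGroup E] [NormedSpace ℂ E] {U : Set ℂ} {f : ℂ → Y → E} {M : ℝ}

theorem differentiableAt_integral_of_norm_le (hU : IsOpen U)
    (hmeas : ∀ z, AEStronglyMeasurable (f z) m) (hdiff : ∀ y, DifferentiableOn ℂ (f · y) U)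
    (hM : ∀ z ∈ U, ∀ y, ‖f z y‖ ≤ M) {z₀ : ℂ} (hz₀ : z₀ ∈ U) :
    DifferentiableAt ℂ (fun z => ∫ y, f z y ∂m) z₀ := by
  obtain ⟨ε, hε, hball⟩ := isOpen_iff.mp hU z₀ hz₀
  have near {z : ℂ} (hz : z ∈ ball z₀ (ε / 2)) : closedBall z (ε / 2) ⊆ U :=
    (closedBall_subset_ball' (by linarith [mem_ball.mp hz])).trans hball
  have hderiv (y : Y) {z : ℂ} (hz : z ∈ U) : HasDerivAt (f · y) (deriv (f · y) z) z :=
    ((hdiff y).differentiableAt (hU.mem_nhds hz)).hasDerivAt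
  -- Cauchy's estimate on discs of radius `ε / 2` dominates the derivatives.
  have hbound (y : Y) {z : ℂ} (hz : z ∈ ball z₀ (ε / 2)) :
      ‖deriv (f · y) z‖ ≤ M / (ε / 2) :=
    Complex.norm_deriv_le_of_forall_mem_sphere_norm_le (half_pos hε)
      ((hdiff y).mono (closure_ball_subset_closedBall.trans (near hz))).diffContOnCl
      fun w hw => hM w (near hz (sphere_subset_closedBall hw)) y
  have hmeas' : AEStronglyMeasurable (fun y => deriv (f · y) z₀) m :=
    aestronglyMeasurable_of_tendsto_ae (𝓝[≠] (0 : ℂ))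
      (fun t => ((hmeas (z₀ + t)).sub (hmeas z₀)).const_smul t⁻¹)
      (Eventually.of_forall fun y => (hderiv y hz₀).tendsto_slope_zero)
  exact (hasDerivAt_integral_of_dominated_loc_of_deriv_le (ball_mem_nhds z₀ (half_pos hε))
    (Eventually.of_forall hmeas) (.of_bound (hmeas z₀) M (Eventually.of_forall (hM z₀ hz₀)))
    hmeas' (Eventually.of_forall fun y z hz => hbound y hz) (integrable_const _)
    (Eventually.of_forall fun y z hz =>
      hderiv y (near hz (mem_closedBall_self (half_pos hε).le)))).2.differentiableAt

theorem diffContOnCl_integral (hU : IsOpen U) (hmeas : ∀ z, AEStronglyMeasurable (f z) m)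
    (hdiff : ∀ y, DiffContOnCl ℂ (f · y) U) (hM : ∀ z ∈ closure U, ∀ y, ‖f z y‖ ≤ M) :
    DiffContOnCl ℂ (fun z => ∫ y, f z y ∂m) U where
  differentiableOn _ hz := (differentiableAt_integral_of_norm_le hU hmeas
    (fun y => (hdiff y).differentiableOn) (fun z hz => hM z (subset_closure hz))
    hz).differentiableWithinAt
  continuousOn := continuousOn_of_dominated (fun z _ => hmeas z)
    (fun z hz => Eventually.of_forall (hM z hz)) (integrable_const M)
    (Eventually.of_forall fun y => (hdiff y).continuousOn)

end HolomorphicIntegral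

section Interpolation

open Complex.HadamardThreeLines

theorem enorm_half_pow_four_le_of_diffContOnCl_verticalStrip {F : ℂ → ℂ}
    (hF : DiffContOnCl ℂ F (verticalStrip 0 1))
    (hbdd : BddAbove ((norm ∘ F) '' verticalClosedStrip 0 1)) {a b : ℝ≥0∞} (ha' : a ≠ ∞)
    (hb' : b ≠ ∞) (ha : ∀ z : ℂ, z.re = 0 → ‖F z‖ₑ ^ 2 ≤ a)
    (hb : ∀ z : ℂ, z.re = 1 → ‖F z‖ₑ ^ 2 ≤ b) : ‖F (1 / 2)‖ₑ ^ 4 ≤ a * b := by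
  lift a to NNReal using ha'
  lift b to NNReal using hb'
  simp only [enorm, ← ENNReal.coe_pow, ← ENNReal.coe_mul, ENNReal.coe_le_coe] at ha hb ⊢
  simp only [← NNReal.coe_le_coe, NNReal.coe_pow, NNReal.coe_mul, coe_nnnorm] at ha hb ⊢
  have three_lines := norm_le_interp_of_mem_verticalClosedStrip₀₁' F (z := 1 / 2)
    (by norm_num [verticalClosedStrip]) hF hbdd
    (fun z hz => Real.le_sqrt_of_sq_le (ha z hz)) (fun z hz => Real.le_sqrt_of_sq_le (hb z hz))
  have re_half : (1 / 2 : ℂ).re = 1 / 2 := by norm_num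
  rw [re_half, show (1 - 1 / 2 : ℝ) = 1 / 2 by norm_num, ← Real.sqrt_eq_rpow,
    ← Real.sqrt_eq_rpow] at three_lines
  calc ‖F (1 / 2)‖ ^ 4 ≤ (√√a * √√b) ^ 4 := pow_le_pow_left₀ (norm_nonneg _) three_lines 4
    _ = ((√√a ^ 2) ^ 2) * ((√√b ^ 2) ^ 2) := by ring
    _ = a * b := by simp only [Real.sq_sqrt, Real.sqrt_nonneg, NNReal.coe_nonneg]

/-- The power `(w / |w|) |w| ^ s`, equal to `0` at `w = 0`. It is entire in `s`, and
`s ↦ phasePow (2 * s) w` runs from modulus `1` over `w` itself to modulus `|w| ^ 2` as `Re s` runs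
from `0` over `1 / 2` to `1`. -/
noncomputable def phasePow (s : ℂ) (w : ℂ) : ℂ := w / ‖w‖ * Complex.exp (s * Real.log ‖w‖)

theorem phasePow_zero (s : ℂ) : phasePow s 0 = 0 := by simp [phasePow]

theorem phasePow_one (w : ℂ) : phasePow 1 w = w := by
  rcases eq_or_ne w 0 with rfl | hw
  · exact phasePow_zero 1
  · have hw' : (‖w‖ : ℂ) ≠ 0 :=
      Complex.ofReal_ne_zero.mpr (norm_ne_zero_iff.mpr hw)
    rw [phasePow, one_mul, ← Complex.ofReal_exp, Real.exp_log (norm_pos_iff.mpr hw),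
      div_mul_cancel₀ _ hw']

theorem phasePow_three_mul_conj (w : ℂ) : phasePow 3 (conj w) * w = ((‖w‖ ^ 4 : ℝ) : ℂ) := by
  rcases eq_or_ne w 0 with rfl | hw
  · simp
  · have hw' : (‖w‖ : ℂ) ≠ 0 :=
      Complex.ofReal_ne_zero.mpr (norm_ne_zero_iff.mpr hw)
    have exp_three : Complex.exp (3 * (Real.log ‖w‖ : ℂ)) = (‖w‖ : ℂ) ^ 3 := by
      rw [show (3 : ℂ) = ((3 : ℕ) : ℂ) by norm_num, Complex.exp_nat_mul, ← Complex.ofReal_exp,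
        Real.exp_log (norm_pos_iff.mpr hw)]
    calc phasePow 3 (conj w) * w = conj w * w * ‖w‖ ^ 2 := by
          rw [phasePow, Complex.norm_conj, exp_three]
          field_simp
      _ = ((‖w‖ ^ 4 : ℝ) : ℂ) := by rw [Complex.conj_mul']; push_cast; ring

theorem norm_phasePow_le (s w : ℂ) : ‖phasePow s w‖ ≤ ‖w‖ ^ s.re := by
  rcases eq_or_ne w 0 with rfl | hw
  · rw [phasePow_zero, norm_zero]
    exact Real.rpow_nonneg le_rfl _
  · have hw' : 0 < ‖w‖ := norm_pos_iff.mpr hw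
    rw [phasePow, norm_mul, Complex.norm_exp, norm_div, Complex.norm_real, norm_norm,
      div_self hw'.ne', one_mul, Real.rpow_def_of_pos hw', Complex.re_mul_ofReal, mul_comm]

theorem norm_phasePow_le_pow {s : ℂ} {n : ℕ} (hs : s.re = n) (w : ℂ) :
    ‖phasePow s w‖ ≤ ‖w‖ ^ n :=
  (norm_phasePow_le s w).trans_eq (by rw [hs, Real.rpow_natCast])

theorem norm_phasePow_le_of_re_le {s w : ℂ} {C : ℝ} {n : ℕ} (hs : 0 ≤ s.re) (hn : s.re ≤ n)
    (hC : 1 ≤ C) (hw : ‖w‖ ≤ C) : ‖phasePow s w‖ ≤ C ^ n :=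
  calc ‖phasePow s w‖ ≤ ‖w‖ ^ s.re := norm_phasePow_le s w
    _ ≤ C ^ s.re := Real.rpow_le_rpow (norm_nonneg _) hw hs
    _ ≤ C ^ (n : ℝ) := Real.rpow_le_rpow_of_exponent_le hC hn
    _ = C ^ n := Real.rpow_natCast C n

theorem measurable_phasePow (s : ℂ) : Measurable (phasePow s) := by
  unfold phasePow; fun_prop

theorem differentiable_phasePow (w : ℂ) : Differentiable ℂ (fun s => phasePow s w) := by
  unfold phasePow; fun_prop

variable {X : Type*} [MeasurableSpace X]

theorem IsBdd.exists_one_le_norm_le {f : X → ℂ} (hf : IsBdd f) :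
    ∃ C : ℝ, 1 ≤ C ∧ ∀ x, ‖f x‖ ≤ C :=
  hf.exists_norm_le.elim fun C hC => ⟨max 1 C, le_max_left _ _, fun x => le_max_of_le_right (hC x)⟩

theorem IsBdd.phasePow {f : X → ℂ} (hf : IsBdd f) {s : ℂ} (hs : 0 ≤ s.re) :
    IsBdd (fun x => phasePow s (f x)) := by
  obtain ⟨C, hC1, hC⟩ := hf.exists_one_le_norm_le
  exact ⟨(measurable_phasePow s).comp hf.measurable, C ^ ⌈s.re⌉₊, fun x =>
    norm_phasePow_le_of_re_le hs (Nat.le_ceil _) hC1 (hC x)⟩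

/-- Convolution with `δ₀ - ν`. -/
noncomputable def convCompl [Sub X] (ν : Measure X) (b : X → ℂ) (x : X) : ℂ :=
  b x - ∫ y, b (x - y) ∂ν

section ConvCompl

variable [Sub X] (ν : Measure X) [IsProbabilityMeasure ν] {b : X → ℂ}

theorem norm_convCompl_le {C : ℝ} (hC : ∀ x, ‖b x‖ ≤ C) (x : X) :
    ‖convCompl ν b x‖ ≤ 2 * C := by
  have hconv : ‖∫ y, b (x - y) ∂ν‖ ≤ C := by
    simpa using
      norm_integral_le_of_norm_le_const (μ := ν) (Eventually.of_forall fun y => hC (x - y))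
  rw [convCompl, two_mul]
  exact (norm_sub_le _ _).trans (add_le_add (hC x) hconv)

variable [MeasurableSub₂ X]

theorem measurable_convCompl (hb : Measurable b) : Measurable (convCompl ν b) :=
  hb.sub (StronglyMeasurable.integral_prod_right' (f := fun p : X × X => b (p.1 - p.2))
    (hb.comp measurable_sub).stronglyMeasurable).measurable

theorem IsBdd.convCompl (hb : IsBdd b) : IsBdd (convCompl ν b) :=
  let ⟨C, hC⟩ := hb.exists_norm_le
  ⟨measurable_convCompl ν hb.measurable, 2 * C, norm_convCompl_le ν hC⟩

end ConvCompl

section InterpolatingFamily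

variable [Sub X] (ν m : Measure X) [IsProbabilityMeasure ν] {b Q : X → ℂ}

/-- The analytic family of the proof of the Riesz–Thorin theorem for the operator `convCompl ν`: the
exponents of `b` and `Q` on the lines `Re z = 0, 1 / 2, 1` are `0, 1, 2` and `4, 3, 2`. -/
noncomputable def interpolatingIntegral (b Q : X → ℂ) (z : ℂ) : ℂ :=
  ∫ x, phasePow (4 - 2 * z) (Q x) * convCompl ν (fun y => phasePow (2 * z) (b y)) x ∂m

theorem closure_verticalStrip_subset : closure (verticalStrip 0 1) ⊆ verticalClosedStrip 0 1 :=
  closure_minimal (Set.preimage_mono Set.Ioo_subset_Icc_self)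
    (isClosed_Icc.preimage Complex.continuous_re)

theorem diffContOnCl_phasePow (w : ℂ) {g : ℂ → ℂ} (hg : Differentiable ℂ g) (U : Set ℂ) :
    DiffContOnCl ℂ (fun z => phasePow (g z) w) U :=
  ((differentiable_phasePow w).comp hg).diffContOnCl

theorem norm_phasePow_two_mul_le {z w : ℂ} {C : ℝ} (hC : 1 ≤ C) (hw : ‖w‖ ≤ C)
    (hz : z ∈ verticalClosedStrip 0 1) : ‖phasePow (2 * z) w‖ ≤ C ^ 2 := by
  obtain ⟨h0, h1⟩ : 0 ≤ z.re ∧ z.re ≤ 1 := hz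
  exact norm_phasePow_le_of_re_le (by simpa using h0) (by simpa using h1) hC hw

theorem norm_phasePow_four_sub_le {z w : ℂ} {C : ℝ} (hC : 1 ≤ C) (hw : ‖w‖ ≤ C)
    (hz : z ∈ verticalClosedStrip 0 1) : ‖phasePow (4 - 2 * z) w‖ ≤ C ^ 4 := by
  obtain ⟨h0, h1⟩ : 0 ≤ z.re ∧ z.re ≤ 1 := hz
  have hre : (4 - 2 * z).re = 4 - 2 * z.re := by simp
  exact norm_phasePow_le_of_re_le (by rw [hre]; linarith) (by rw [hre]; push_cast; linarith) hC hw

theorem exists_norm_phasePow_mul_convCompl_le (hb : IsBdd b) (hQ : IsBdd Q) :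
    ∃ M : ℝ, ∀ z ∈ verticalClosedStrip 0 1, ∀ x,
      ‖phasePow (4 - 2 * z) (Q x) * convCompl ν (fun y => phasePow (2 * z) (b y)) x‖ ≤ M := by
  obtain ⟨C, hC1, hC⟩ := hb.exists_one_le_norm_le
  obtain ⟨D, hD1, hD⟩ := hQ.exists_one_le_norm_le
  refine ⟨D ^ 4 * (2 * C ^ 2), fun z hz x => ?_⟩
  rw [norm_mul]
  exact mul_le_mul (norm_phasePow_four_sub_le hD1 (hD x) hz)
    (norm_convCompl_le ν (fun y => norm_phasePow_two_mul_le hC1 (hC y) hz) x)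
    (norm_nonneg _) (by positivity)

theorem bddAbove_norm_interpolatingIntegral [IsFiniteMeasure m] (hb : IsBdd b)
    (hQ : IsBdd Q) :
    BddAbove ((norm ∘ interpolatingIntegral ν m b Q) '' verticalClosedStrip 0 1) := by
  obtain ⟨M, hM⟩ := exists_norm_phasePow_mul_convCompl_le ν hb hQ
  refine ⟨M * m.real Set.univ, ?_⟩
  rintro _ ⟨z, hz, rfl⟩
  exact norm_integral_le_of_norm_le_const (Eventually.of_forall (hM z hz))

theorem enorm_interpolatingIntegral_le_of_re_eq_zero {z : ℂ} (hz : z.re = 0) :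
    ‖interpolatingIntegral ν m b Q z‖ₑ ≤ 2 * ∫⁻ x, ‖Q x‖ₑ ^ 4 ∂m := by
  have hP (y : X) : ‖phasePow (2 * z) (b y)‖ ≤ 1 := by
    simpa using norm_phasePow_le_pow (n := 0) (s := 2 * z) (by simp [hz]) (b y)
  have hQ (x : X) : ‖phasePow (4 - 2 * z) (Q x)‖ ≤ ‖Q x‖ ^ 4 :=
    norm_phasePow_le_pow (by simp [hz]) _
  calc ‖interpolatingIntegral ν m b Q z‖ₑ
      ≤ ∫⁻ x, ENNReal.ofReal (‖Q x‖ ^ 4 * (2 * 1)) ∂m := by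
        refine (enorm_integral_le_lintegral_enorm _).trans (lintegral_mono fun x => ?_)
        rw [← ofReal_norm, norm_mul]
        exact ENNReal.ofReal_le_ofReal (mul_le_mul (hQ x) (norm_convCompl_le ν hP x)
          (norm_nonneg _) (by positivity))
    _ = 2 * ∫⁻ x, ‖Q x‖ₑ ^ 4 ∂m := by
        rw [← lintegral_const_mul' _ _ ENNReal.ofNat_ne_top]
        simp [ENNReal.ofReal_mul, ENNReal.ofReal_pow, mul_comm]

variable [MeasurableSub₂ X]

theorem enorm_interpolatingIntegral_sq_le_of_re_eq_one (hb : IsBdd b) (hQ : IsBdd Q)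
    (hL2 : ∀ g : X → ℂ, IsBdd g → ∫⁻ x, ‖convCompl ν g x‖ₑ ^ 2 ∂m ≤ ∫⁻ x, ‖g x‖ₑ ^ 2 ∂m)
    {z : ℂ} (hz : z.re = 1) :
    ‖interpolatingIntegral ν m b Q z‖ₑ ^ 2
      ≤ (∫⁻ x, ‖Q x‖ₑ ^ 4 ∂m) * ∫⁻ x, ‖b x‖ₑ ^ 4 ∂m := by
  have hsq {s w : ℂ} (hs : s.re = 2) : ‖phasePow s w‖ₑ ^ 2 ≤ ‖w‖ₑ ^ 4 := by
    rw [show 4 = 2 * 2 from rfl, pow_mul, ← enorm_pow w]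
    refine pow_le_pow_left' (enorm_le_iff_norm_le.mpr ?_) 2
    rw [norm_pow]
    exact norm_phasePow_le_pow (by exact_mod_cast hs) w
  have hP : IsBdd fun y => phasePow (2 * z) (b y) := hb.phasePow (by simp [hz])
  refine (enorm_integral_mul_sq_le ((measurable_phasePow _).comp hQ.measurable).aemeasurable
    (measurable_convCompl ν hP.measurable).aemeasurable).trans (mul_le_mul' ?_ ?_)
  · exact lintegral_mono fun x => hsq (by simp [hz]; norm_num)
  · exact (hL2 _ hP).trans (lintegral_mono fun x => hsq (by simp [hz]))

theorem diffContOnCl_convCompl_phasePow (hb : IsBdd b) (x : X) :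
    DiffContOnCl ℂ (fun z => convCompl ν (fun y => phasePow (2 * z) (b y)) x)
      (verticalStrip 0 1) := by
  obtain ⟨C, hC1, hC⟩ := hb.exists_one_le_norm_le
  have hdiff (y : X) := diffContOnCl_phasePow (b y) (differentiable_id.const_mul (2 : ℂ))
    (verticalStrip 0 1)
  refine (hdiff x).sub (diffContOnCl_integral (isOpen_Ioo.preimage Complex.continuous_re)
    (fun z => ?_) (fun y => hdiff (x - y)) (M := C ^ 2) fun z hz y =>
      norm_phasePow_two_mul_le hC1 (hC _) (closure_verticalStrip_subset hz))
  exact ((measurable_phasePow _).comp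
    (hb.measurable.comp (measurable_id.const_sub x))).aestronglyMeasurable

variable [IsFiniteMeasure m]

theorem diffContOnCl_interpolatingIntegral (hb : IsBdd b) (hQ : IsBdd Q) :
    DiffContOnCl ℂ (interpolatingIntegral ν m b Q) (verticalStrip 0 1) := by
  obtain ⟨M, hM⟩ := exists_norm_phasePow_mul_convCompl_le ν hb hQ
  refine diffContOnCl_integral (isOpen_Ioo.preimage Complex.continuous_re) (fun z => ?_)
    (fun x => ?_) (M := M) fun z hz => hM z (closure_verticalStrip_subset hz)
  · exact (((measurable_phasePow _).comp hQ.measurable).mul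
      (measurable_convCompl ν ((measurable_phasePow _).comp hb.measurable))).aestronglyMeasurable
  · exact (diffContOnCl_phasePow (Q x) (by fun_prop) _).smul
      (diffContOnCl_convCompl_phasePow ν hb x)

theorem enorm_interpolatingIntegral_half (hb : IsBdd b) :
    ‖interpolatingIntegral ν m b (fun x => conj (convCompl ν b x)) (1 / 2)‖ₑ
      = ∫⁻ x, ‖convCompl ν b x‖ₑ ^ 4 ∂m := by
  have h : interpolatingIntegral ν m b (fun x => conj (convCompl ν b x)) (1 / 2)
      = ((∫ x, ‖convCompl ν b x‖ ^ 4 ∂m : ℝ) : ℂ) := by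
    rw [interpolatingIntegral, ← integral_complex_ofReal]
    norm_num [phasePow_one, phasePow_three_mul_conj]
  rw [h, ← (hb.convCompl ν).ofReal_integral_norm_pow m four_ne_zero, ← ofReal_norm,
    Complex.norm_real, Real.norm_of_nonneg (integral_nonneg fun x => by positivity)]

/-- Riesz–Thorin between the trivial bound `2` on `L^∞` and the bound `1` on `L^2`. -/
theorem lintegral_enorm_convCompl_pow_four_le (hb : IsBdd b)
    (hL2 : ∀ g : X → ℂ, IsBdd g → ∫⁻ x, ‖convCompl ν g x‖ₑ ^ 2 ∂m ≤ ∫⁻ x, ‖g x‖ₑ ^ 2 ∂m) :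
    ∫⁻ x, ‖convCompl ν b x‖ₑ ^ 4 ∂m ≤ 4 * ∫⁻ x, ‖b x‖ₑ ^ 4 ∂m := by
  set G := ∫⁻ x, ‖convCompl ν b x‖ₑ ^ 4 ∂m
  set B := ∫⁻ x, ‖b x‖ₑ ^ 4 ∂m
  have hQ : IsBdd fun x => conj (convCompl ν b x) := (hb.convCompl ν).star
  have hG : ∫⁻ x, ‖conj (convCompl ν b x)‖ₑ ^ 4 ∂m = G := by simp only [RCLike.enorm_conj, G]
  have hG' : G ≠ ∞ := (hb.convCompl ν).lintegral_enorm_pow_ne_top m four_ne_zero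
  have hB' : B ≠ ∞ := hb.lintegral_enorm_pow_ne_top m four_ne_zero
  have midpoint : G ^ 4 ≤ (2 * G) ^ 2 * (G * B) := by
    refine (congrArg (· ^ 4) (enorm_interpolatingIntegral_half ν m hb)).symm.trans_le ?_
    refine enorm_half_pow_four_le_of_diffContOnCl_verticalStrip
      (diffContOnCl_interpolatingIntegral ν m hb hQ) (bddAbove_norm_interpolatingIntegral ν m hb hQ)
      (by finiteness) (by finiteness) (fun z hz => ?_) (fun z hz => ?_)
    · exact pow_le_pow_left' (hG ▸ enorm_interpolatingIntegral_le_of_re_eq_zero ν m hz) 2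
    · exact hG ▸ enorm_interpolatingIntegral_sq_le_of_re_eq_one ν m hb hQ hL2 hz
  rcases eq_or_ne G 0 with h0 | h0
  · rw [h0]; exact zero_le
  · rw [← ENNReal.mul_le_mul_iff_right (pow_ne_zero 3 h0) (ENNReal.pow_ne_top hG')]
    calc G ^ 3 * G = G ^ 4 := by ring
      _ ≤ (2 * G) ^ 2 * (G * B) := midpoint
      _ = G ^ 3 * (4 * B) := by ring

end InterpolatingFamily

end Interpolation

section Translation

variable {G H : Type*} [AddCommGroup G] [MeasurableSpace G] [AddCommGroup H] [MeasurableSpace H]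
  {τ : H →+ G} (hτ : Measurable τ)
include hτ

theorem convCompl_map_apply [MeasurableSub G] (ν : Measure H) {b : G → ℂ} (hb : Measurable b)
    (u : G) : convCompl (ν.map τ) b u = b u - ∫ y, b (u - τ y) ∂ν := by
  rw [convCompl, integral_map (f := fun y => b (u - y)) hτ.aemeasurable
    (hb.comp (measurable_id.const_sub u)).aestronglyMeasurable]

theorem convCompl_map_add [MeasurableSub G] (ν : Measure H) {b : G → ℂ} (hb : Measurable b)
    (u : G) (t : H) :
    convCompl (ν.map τ) b (u + τ t) = convCompl ν (fun s => b (u + τ s)) t := by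
  rw [convCompl_map_apply hτ ν hb, convCompl]
  simp only [map_sub, add_sub_assoc]

variable [MeasurableAdd₂ G] (m : Measure G) [SFinite m] [m.IsAddRightInvariant] (n : Measure H)
  [IsProbabilityMeasure n]

theorem lintegral_eq_lintegral_lintegral_add {F : G → ℝ≥0∞} (hF : Measurable F) :
    ∫⁻ u, F u ∂m = ∫⁻ u, ∫⁻ t, F (u + τ t) ∂n ∂m := by
  rw [lintegral_lintegral_swap (f := fun u t => F (u + τ t))
    (hF.comp (measurable_fst.add (hτ.comp measurable_snd))).aemeasurable]
  simp [lintegral_add_right_eq_self]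

/-- On each coset of the range of `τ` the operator is `convCompl ν` itself. -/
theorem lintegral_enorm_convCompl_map_pow_le [MeasurableSub₂ G] (ν : Measure H)
    [IsProbabilityMeasure ν] {C : ℝ≥0∞} {p : ℕ}
    (h : ∀ g : H → ℂ, IsBdd g → ∫⁻ t, ‖convCompl ν g t‖ₑ ^ p ∂n ≤ C * ∫⁻ t, ‖g t‖ₑ ^ p ∂n)
    {b : G → ℂ} (hb : IsBdd b) :
    ∫⁻ u, ‖convCompl (ν.map τ) b u‖ₑ ^ p ∂m ≤ C * ∫⁻ u, ‖b u‖ₑ ^ p ∂m := by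
  have : IsProbabilityMeasure (ν.map τ) := Measure.isProbabilityMeasure_map hτ.aemeasurable
  have hbp : Measurable fun u => ‖b u‖ₑ ^ p := hb.measurable.enorm.pow_const p
  rw [lintegral_eq_lintegral_lintegral_add hτ m n
      ((hb.convCompl (ν.map τ)).measurable.enorm.pow_const p),
    lintegral_eq_lintegral_lintegral_add hτ m n hbp, ← lintegral_const_mul C
      (Measurable.lintegral_prod_right' (f := fun q : G × H => ‖b (q.1 + τ q.2)‖ₑ ^ p)
        (hbp.comp (measurable_fst.add (hτ.comp measurable_snd))))]
  refine lintegral_mono fun u => ?_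
  simp only [convCompl_map_add hτ ν hb.measurable]
  exact h _ (hb.comp (hτ.const_add u))

end Translation

section Torus

open UnitAddTorus

variable {d : ℕ} (ν : Measure (Torus d)) [IsProbabilityMeasure ν] {b : Torus d → ℂ}

theorem coeff_convCompl (hb : IsBdd b) (c : Fin d → ℤ) :
    coeff (convCompl ν b) c = (1 - ∫ y, mFourier (-c) y ∂ν) * coeff b c := by
  have hχ := isBdd_mFourier (-c)
  have hshift : IsBdd fun p : Torus d × Torus d => b (p.1 - p.2) := hb.comp measurable_sub
  have translate (y : Torus d) :
      ∫ x, mFourier (-c) x * b (x - y) = mFourier (-c) y * coeff b c := by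
    rw [coeff, ← integral_add_right_eq_self _ y, ← integral_const_mul]
    refine integral_congr_ae (Eventually.of_forall fun x => ?_)
    simp only [add_sub_cancel_right, mFourier_add_apply]
    ring
  have conv : coeff (fun x => ∫ y, b (x - y) ∂ν) c = (∫ y, mFourier (-c) y ∂ν) * coeff b c := by
    simp only [coeff, ← integral_const_mul (μ := ν)]
    rw [((hχ.comp measurable_fst).mul hshift).integral_integral_swap
      (F := fun x y => mFourier (-c) x * b (x - y))]
    simp only [translate, integral_mul_const, coeff]
  rw [sub_mul, one_mul, ← conv]
  simp only [coeff, convCompl, mul_sub]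
  exact integral_sub ((hχ.mul hb).integrable _) ((hχ.mul (hshift.integral ν)).integrable _)

variable (hν : ∀ c, ‖1 - ∫ y, mFourier (-c) y ∂ν‖ ≤ 1)
include hν

theorem enorm_coeff_convCompl_le (hb : IsBdd b) (c : Fin d → ℤ) :
    ‖coeff (convCompl ν b) c‖ₑ ≤ ‖coeff b c‖ₑ := by
  rw [coeff_convCompl ν hb, enorm_mul]
  exact mul_le_of_le_one_left'
    ((enorm_le_iff_norm_le.mpr ((hν c).trans_eq norm_one.symm)).trans_eq (enorm_one (G := ℂ)))

theorem lintegral_enorm_convCompl_sq_le (hb : IsBdd b) :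
    ∫⁻ x, ‖convCompl ν b x‖ₑ ^ 2 ≤ ∫⁻ x, ‖b x‖ₑ ^ 2 := by
  rw [lintegral_enorm_sq_eq_tsum_coeff (hb.convCompl ν), lintegral_enorm_sq_eq_tsum_coeff hb]
  exact ENNReal.tsum_le_tsum fun c => pow_le_pow_left' (enorm_coeff_convCompl_le ν hν hb c) 2

theorem lintegral_enorm_convCompl_map_pow_four_le {G : Type*} [AddCommGroup G] [MeasurableSpace G]
    [MeasurableAdd₂ G] [MeasurableSub₂ G] (m : Measure G) [SFinite m] [m.IsAddRightInvariant]
    {τ : Torus d →+ G} (hτ : Measurable τ) {b : G → ℂ} (hb : IsBdd b) :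
    ∫⁻ u, ‖convCompl (ν.map τ) b u‖ₑ ^ 4 ∂m ≤ 4 * ∫⁻ u, ‖b u‖ₑ ^ 4 ∂m :=
  lintegral_enorm_convCompl_map_pow_le hτ m volume ν (fun _ hg =>
    lintegral_enorm_convCompl_pow_four_le ν volume hg fun _ =>
      lintegral_enorm_convCompl_sq_le ν hν) hb

end Torus

section HighPass

open UnitAddTorus

variable {d m : ℕ} {φ : C(Torus d, ℝ)}

instance : MeasurableSub₂ (Cube d m) := ContinuousSub.measurableSub₂

/-- The measure with density `φ` (with density `max φ 0` if `φ` takes negative values). -/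
noncomputable def kernelMeasure (φ : C(Torus d, ℝ)) : Measure (Torus d) :=
  volume.withDensity fun x => ENNReal.ofReal (φ x)

/-- The embedding `𝕋^d → 𝕋^d × (𝕋^d)^m` along which `partialConv φ j` averages. -/
noncomputable def direction (j : Fin (m + 1)) : Torus d →+ Cube d m :=
  Fin.lastCases (motive := fun _ => Torus d →+ Cube d m) (.inl _ _)
    (fun i => (AddMonoidHom.inr _ _).comp (.single (fun _ => Torus d) i)) j

theorem direction_last (y : Torus d) : direction (Fin.last m) y = (y, 0) := by
  simp [direction]

theorem direction_castSucc (i : Fin m) (y : Torus d) :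
    direction i.castSucc y = (0, Pi.single i y) := by
  simp [direction]

theorem measurable_direction (j : Fin (m + 1)) :
    Measurable (direction j : Torus d →+ Cube d m) := by
  cases j using Fin.lastCases with
  | last => simpa only [funext direction_last] using measurable_prodMk_right
  | cast i => simpa only [funext (direction_castSucc i)] using
      measurable_const.prodMk (continuous_single (A := fun _ => Torus d) i).measurable

variable (hφ : ∀ x, 0 ≤ φ x)
include hφ

theorem integral_kernelMeasure (g : Torus d → ℂ) :
    ∫ y, g y ∂kernelMeasure φ = ∫ y, (φ y : ℂ) * g y := by
  rw [kernelMeasure, integral_withDensity_eq_integral_toReal_smul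
    φ.continuous.measurable.ennreal_ofReal (by simp)]
  simp only [ENNReal.toReal_ofReal (hφ _), Complex.real_smul]

theorem isProbabilityMeasure_kernelMeasure (hφ1 : ∫ x, φ x = 1) :
    IsProbabilityMeasure (kernelMeasure φ) := by
  refine ⟨?_⟩
  rw [kernelMeasure, withDensity_apply _ .univ, setLIntegral_univ,
    ← ofReal_integral_eq_lintegral_ofReal (φ.continuous.integrable_of_hasCompactSupport
      (.of_compactSpace _)) (Eventually.of_forall hφ), hφ1, ENNReal.ofReal_one]

theorem integral_mFourier_kernelMeasure (c : Fin d → ℤ) :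
    ∫ y, mFourier (-c) y ∂kernelMeasure φ = kernelCoeff φ c := by
  simp only [integral_kernelMeasure hφ, kernelCoeff, mul_comm]

theorem highPass_eq_convCompl (j : Fin (m + 1)) {A : Cube d m → ℂ} (hA : Measurable A) :
    highPass φ j A = convCompl ((kernelMeasure φ).map (direction j)) A := by
  funext p
  rw [convCompl_map_apply (measurable_direction j) _ hA, integral_kernelMeasure hφ, highPass]
  congr 1
  cases j using Fin.lastCases with
  | last => simp only [partialConv, Fin.lastCases_last, direction_last, Prod.sub_def, sub_zero]
  | cast i =>
    have update_eq (y : Torus d) : Function.update p.2 i (p.2 i - y) = p.2 - Pi.single i y := by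
      rw [Function.update_eq_iff]
      constructor
      · simp
      · intro l hl
        simp [hl]
    simp only [partialConv, Fin.lastCases_castSucc, direction_castSucc, Prod.sub_def, sub_zero,
      update_eq]

theorem IsBdd.highPass (hφ1 : ∫ x, φ x = 1) (j : Fin (m + 1)) {A : Cube d m → ℂ} (hA : IsBdd A) :
    IsBdd (highPass φ j A) := by
  have := isProbabilityMeasure_kernelMeasure hφ hφ1
  have := Measure.isProbabilityMeasure_map (μ := kernelMeasure φ)
    (measurable_direction j).aemeasurable
  rw [highPass_eq_convCompl hφ j hA.measurable]
  exact hA.convCompl _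

end HighPass

variable {d m : ℕ}

section Snoc

theorem measurePreserving_snoc :
    MeasurePreserving (fun p : Torus d × (Fin m → Torus d) =>
      (Fin.snoc p.2 p.1 : Fin (m + 1) → Torus d)) volume volume := by
  have h := (volume_preserving_piFinSuccAbove (fun _ : Fin (m + 1) => Torus d) (Fin.last m)).symm
  have snoc_eq : ⇑(MeasurableEquiv.piFinSuccAbove (fun _ : Fin (m + 1) => Torus d)
      (Fin.last m)).symm = fun p => Fin.snoc p.2 p.1 :=
    funext fun p => Fin.insertNth_last' p.1 p.2
  rwa [snoc_eq] at h

theorem measurable_init : Measurable fun u : Fin (m + 1) → Torus d => Fin.init u :=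
  measurable_pi_lambda _ fun i => measurable_pi_apply i.castSucc

theorem measurable_snoc {X : Type*} [MeasurableSpace X] {f : X → Fin m → Torus d}
    {g : X → Torus d} (hf : Measurable f) (hg : Measurable g) :
    Measurable fun x => (Fin.snoc (f x) (g x) : Fin (m + 1) → Torus d) :=
  measurePreserving_snoc.measurable.comp (hg.prodMk hf)

theorem lintegral_snoc {F : (Fin (m + 1) → Torus d) → ℝ≥0∞} (hF : Measurable F) :
    ∫⁻ u, F u = ∫⁻ u', ∫⁻ v, F (Fin.snoc u' v) := by
  rw [← measurePreserving_snoc.lintegral_comp hF, Measure.volume_eq_prod,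
    lintegral_prod_symm (fun a : Torus d × (Fin m → Torus d) => F (Fin.snoc a.2 a.1))
      (hF.comp measurePreserving_snoc.measurable).aemeasurable]

theorem integral_snoc {F : (Fin (m + 1) → Torus d) → ℂ} (hF : IsBdd F) :
    ∫ u, F u = ∫ u', ∫ v, F (Fin.snoc u' v) := by
  have hs := measurePreserving_snoc (d := d) (m := m)
  rw [← hs.map_eq, integral_map hs.measurable.aemeasurable
    hF.measurable.aestronglyMeasurable, Measure.volume_eq_prod,
    integral_prod_symm _ ((hF.comp hs.measurable).integrable _)]

end Snoc

section Cross

variable {A B : Cube d m → ℂ}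

theorem IsBdd.cross (hA : IsBdd A) (hB : IsBdd B) : IsBdd (cross A B) := by
  have hinit : Measurable fun p : Cube d (m + 1) => Fin.init p.2 :=
    measurable_init.comp measurable_snd
  exact (hA.comp (measurable_fst.prodMk hinit)).mul (hB.comp (Measurable.prodMk
    (measurable_fst.sub ((measurable_pi_apply (Fin.last m)).comp measurable_snd)) hinit)).star

theorem cross_snoc (A B : Cube d m → ℂ) (x : Torus d) (u : Fin m → Torus d) (v : Torus d) :
    cross A B (x, Fin.snoc u v) = A (x, u) * conj (B (x - v, u)) := by
  simp [cross]

theorem IsBdd.slice (hA : IsBdd A) (u : Fin m → Torus d) : IsBdd fun x => A (x, u) :=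
  hA.comp measurable_prodMk_right

/-- The integral over the variable `x`. -/
noncomputable def marg (A : Cube d m → ℂ) (u : Fin m → Torus d) : ℂ := ∫ x, A (x, u)

theorem IsBdd.marg (hA : IsBdd A) : IsBdd (marg A) :=
  IsBdd.integral (F := fun p : (Fin m → Torus d) × Torus d => A (p.2, p.1))
    (hA.comp measurable_swap) volume

theorem integral_eq_integral_marg (hA : IsBdd A) : ∫ p, A p = ∫ u, marg A u := by
  rw [Measure.volume_eq_prod, integral_prod_symm _ (hA.integrable _)]; rfl

theorem marg_cross_snoc (A B : Cube d m → ℂ) (u : Fin m → Torus d) (v : Torus d) :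
    marg (cross A B) (Fin.snoc u v) = corr (fun x => A (x, u)) (fun x => B (x, u)) v := by
  simp only [marg, corr, cross_snoc]

theorem integral_cross (hA : IsBdd A) (hB : IsBdd B) :
    ∫ p, cross A B p = ∫ u, marg A u * conj (marg B u) := by
  rw [integral_eq_integral_marg (hA.cross hB), integral_snoc (hA.cross hB).marg]
  refine integral_congr_ae (Eventually.of_forall fun u => ?_)
  have h := coeff_corr (hA.slice u) (hB.slice u) 0
  simp only [coeff_zero] at h
  simp only [marg_cross_snoc]
  exact h

theorem enorm_integral_cross_sq_le (hA : IsBdd A) (hB : IsBdd B) :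
    ‖∫ p, cross A B p‖ₑ ^ 2 ≤ (∫⁻ u, ‖marg A u‖ₑ ^ 2) * ∫⁻ u, ‖marg B u‖ₑ ^ 2 := by
  rw [integral_cross hA hB]
  simpa only [RCLike.enorm_conj] using enorm_integral_mul_sq_le hA.marg.measurable.aemeasurable
    hB.marg.star.measurable.aemeasurable

theorem enorm_integral_cross_self (hA : IsBdd A) :
    ‖∫ p, cross A A p‖ₑ = ∫⁻ u, ‖marg A u‖ₑ ^ 2 := by
  have h : ∫ p, cross A A p = ((∫ u, ‖marg A u‖ ^ 2 : ℝ) : ℂ) := by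
    rw [integral_cross hA hA, ← integral_complex_ofReal]
    simp only [Complex.mul_conj', Complex.ofReal_pow]
  rw [h, ← hA.marg.ofReal_integral_norm_pow volume two_ne_zero, ← ofReal_norm, Complex.norm_real,
    Real.norm_of_nonneg (integral_nonneg fun u => by positivity)]

end Cross

section Energy

variable {A B : Cube d m → ℂ}

/-- Fourier coefficients in the variable `x`. -/
noncomputable def pcoeff (A : Cube d m → ℂ) (c : Fin d → ℤ) (u : Fin m → Torus d) : ℂ :=
  coeff (fun x => A (x, u)) c

theorem IsBdd.pcoeff (hA : IsBdd A) (c : Fin d → ℤ) : IsBdd (pcoeff A c) :=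
  IsBdd.integral (F := fun p : (Fin m → Torus d) × Torus d =>
    UnitAddTorus.mFourier (-c) p.2 * A (p.2, p.1))
    (((isBdd_mFourier _).comp measurable_snd).mul (hA.comp measurable_swap)) volume

/-- The energy `∫ ∑_c |Â(c; u)|² |B̂(c; u)|² du`, where `Â` and `B̂` are Fourier transforms in the
variable `x`. -/
noncomputable def energy (A B : Cube d m → ℂ) : ℝ≥0∞ :=
  ∫⁻ u, ∑' c, ‖pcoeff A c u‖ₑ ^ 2 * ‖pcoeff B c u‖ₑ ^ 2

theorem lintegral_marg_cross (hA : IsBdd A) (hB : IsBdd B) :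
    ∫⁻ u, ‖marg (cross A B) u‖ₑ ^ 2 = energy A B := by
  rw [lintegral_snoc ((hA.cross hB).marg.measurable.enorm.pow_const 2)]
  refine lintegral_congr fun u => ?_
  simp only [marg_cross_snoc]
  exact lintegral_enorm_corr_sq (hA.slice u) (hB.slice u)

theorem energy_eq_tsum (hA : IsBdd A) (hB : IsBdd B) :
    energy A B = ∑' c, ∫⁻ u, ‖pcoeff A c u‖ₑ ^ 2 * ‖pcoeff B c u‖ₑ ^ 2 :=
  lintegral_tsum fun c => (((hA.pcoeff c).measurable.enorm.pow_const 2).mul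
    ((hB.pcoeff c).measurable.enorm.pow_const 2)).aemeasurable

theorem energy_sq_le (hA : IsBdd A) (hB : IsBdd B) :
    energy A B ^ 2 ≤ energy A A * energy B B := by
  let F (A : Cube d m → ℂ) (p : (Fin d → ℤ) × (Fin m → Torus d)) := ‖pcoeff A p.1 p.2‖ₑ ^ 2
  have hF {A} (hA : IsBdd A) : Measurable (F A) :=
    measurable_from_prod_countable_right fun c => (hA.pcoeff c).measurable.enorm.pow_const 2
  have energy_eq {A B} (hA : IsBdd A) (hB : IsBdd B) :
      energy A B = ∫⁻ p, F A p * F B p ∂(Measure.count.prod volume) := by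
    rw [energy_eq_tsum hA hB, lintegral_prod (fun p => F A p * F B p)
      ((hF hA).mul (hF hB)).aemeasurable, lintegral_count]
  rw [energy_eq hA hB, energy_eq hA hA, energy_eq hB hB]
  simpa only [← sq] using
    sq_lintegral_mul_le (hF hA).aemeasurable (hF hB).aemeasurable

/-- The character `(x; u) ↦ e^{2πi (ξ·x + η_1·u_1 + ⋯ + η_m·u_m)}` of `𝕋^d × (𝕋^d)^m`. -/
noncomputable def cubeChar (ξ : Fin d → ℤ) (η : Fin m → Fin d → ℤ) : C(Cube d m, ℂ) where
  toFun p := UnitAddTorus.mFourier ξ p.1 * multiChar η p.2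
  continuous_toFun := by fun_prop

theorem fourierCoeffMeasure_eq_cintegral_cubeChar (D : ComplexMeasure (Cube d m))
    (ξ : Fin d → ℤ) (η : Fin m → Fin d → ℤ) :
    fourierCoeffMeasure D ξ η = cintegral D (cubeChar (-ξ) (-η)) := rfl

theorem tsum_enorm_integral_cubeChar_mul_sq_le {A : Cube d m → ℂ} (hA : IsBdd A) :
    ∑' η, ‖∫ p, cubeChar (-0) (-η) p * A p‖ₑ ^ 2 ≤ ∫⁻ u, ‖marg A u‖ₑ ^ 2 := by
  have integral_eq (η : Fin m → Fin d → ℤ) :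
      ∫ p, cubeChar (-0) (-η) p * A p = ∫ u, multiChar (-η) u * marg A u := by
    rw [integral_eq_integral_marg ((IsBdd.of_continuous (cubeChar _ _).continuous).mul hA)]
    simp [marg, cubeChar, integral_const_mul, UnitAddTorus.mFourier_zero]
  simp only [integral_eq]
  exact tsum_enorm_integral_multiChar_sq_le hA.marg

end Energy

section HighPass

open UnitAddTorus

variable {φ : C(Torus d, ℝ)} (hφ : ∀ x, 0 ≤ φ x) {A : Cube d m → ℂ}
include hφ

theorem pcoeff_highPass_last (hA : IsBdd A) (c : Fin d → ℤ) (u : Fin m → Torus d) :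
    pcoeff (highPass φ (Fin.last m) A) c u
      = coeff (convCompl (kernelMeasure φ) fun x => A (x, u)) c := by
  rw [pcoeff, highPass_eq_convCompl hφ _ hA.measurable]
  congr 1
  funext x
  simp only [convCompl_map_apply (measurable_direction _) _ hA.measurable, direction_last,
    Prod.mk_sub_mk, sub_zero]
  rfl

theorem pcoeff_highPass_castSucc (hφ1 : ∫ x, φ x = 1) (hA : IsBdd A) (i : Fin m)
    (c : Fin d → ℤ) :
    pcoeff (highPass φ i.castSucc A) c
      = convCompl ((kernelMeasure φ).map (AddMonoidHom.single (fun _ => Torus d) i))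
        (pcoeff A c) := by
  have := isProbabilityMeasure_kernelMeasure hφ hφ1
  have hsingle : Measurable (AddMonoidHom.single (fun _ : Fin m => Torus d) i) :=
    (continuous_single (A := fun _ => Torus d) i).measurable
  funext u
  have hχ := isBdd_mFourier (-c)
  have hshift : IsBdd fun q : Torus d × Torus d => A (q.1, u - Pi.single i q.2) :=
    hA.comp (measurable_fst.prodMk ((hsingle.comp measurable_snd).const_sub u))
  rw [convCompl_map_apply hsingle _ (hA.pcoeff c).measurable]
  simp only [pcoeff, highPass_eq_convCompl hφ _ hA.measurable, coeff,
    convCompl_map_apply (measurable_direction _) _ hA.measurable, direction_castSucc,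
    Prod.mk_sub_mk, sub_zero, mul_sub, AddMonoidHom.single_apply]
  rw [integral_sub ((hχ.mul (hA.slice u)).integrable _)
    ((hχ.mul (hshift.integral _)).integrable _)]
  simp only [← integral_const_mul]
  rw [((hχ.comp measurable_fst).mul hshift).integral_integral_swap
    (m := volume) (n := kernelMeasure φ)
    (F := fun x y => mFourier (-c) x * A (x, u - (Pi.single i y : Fin m → Torus d)))]

theorem energy_highPass_le (hφ1 : ∫ x, φ x = 1) (hφc : ∀ c, ‖1 - kernelCoeff φ c‖ ≤ 1)
    (hA : IsBdd A) (j : Fin (m + 1)) :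
    energy (highPass φ j A) (highPass φ j A) ≤ 4 * energy A A := by
  have := isProbabilityMeasure_kernelMeasure hφ hφ1
  simp only [← integral_mFourier_kernelMeasure hφ] at hφc
  have hH := hA.highPass hφ hφ1 j
  rw [energy_eq_tsum hH hH, energy_eq_tsum hA hA, ← ENNReal.tsum_mul_left]
  simp only [← pow_add]
  refine ENNReal.tsum_le_tsum fun c => ?_
  cases j using Fin.lastCases with
  | last =>
    simp only [pcoeff_highPass_last hφ hA]
    exact (lintegral_mono fun u => pow_le_pow_left'
      (enorm_coeff_convCompl_le _ hφc (hA.slice u) c) 4).trans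
      (le_mul_of_one_le_left' (by norm_num))
  | cast i =>
    rw [pcoeff_highPass_castSucc hφ hφ1 hA]
    exact lintegral_enorm_convCompl_map_pow_four_le _ hφc volume
      (continuous_single (A := fun _ => Torus d) i).measurable (hA.pcoeff c)

end HighPass

section Gowers

theorem prod_snoc {M : Type*} [CommMonoid M] (F : (Fin (m + 1) → Bool) → M) :
    ∏ ι, F ι = (∏ ι : Fin m → Bool, F (Fin.snoc ι false))
      * ∏ ι : Fin m → Bool, F (Fin.snoc ι true) := by
  rw [← (Fin.snocEquiv fun _ : Fin (m + 1) => Bool).prod_comp, Fintype.prod_prod_type,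
    Fintype.prod_bool, mul_comm]
  rfl

theorem isBdd_deltaFun : ∀ (m : ℕ) {f : (Fin m → Bool) → Torus d → ℂ}, (∀ ι, IsBdd (f ι)) →
    IsBdd (deltaFun m f)
  | 0, _, hf => (hf _).comp measurable_fst
  | m + 1, _, hf => (isBdd_deltaFun m fun _ => hf _).cross (isBdd_deltaFun m fun _ => hf _)

/-- The Gowers inner product `∫ Δ^m f` of a family of functions. -/
noncomputable def gowersInner (m : ℕ) (f : (Fin m → Bool) → Torus d → ℂ) : ℂ :=
  ∫ p, deltaFun m f p

/-- The uniformity norm `‖a‖_{U^m}` of a function, to which `uNorm m μ` corresponds for measures. -/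
noncomputable def gowersNorm (m : ℕ) (a : Torus d → ℂ) : ℝ≥0∞ :=
  ‖gowersInner m fun _ => a‖ₑ ^ ((1 : ℝ) / 2 ^ m)

theorem gowersNorm_pow (m : ℕ) (a : Torus d → ℂ) :
    gowersNorm m a ^ 2 ^ m = ‖gowersInner m fun _ => a‖ₑ := by
  rw [gowersNorm, ← ENNReal.rpow_natCast, ← ENNReal.rpow_mul, Nat.cast_pow, Nat.cast_ofNat,
    one_div_mul_cancel (by positivity), ENNReal.rpow_one]

theorem gowersNorm_zero (m : ℕ) : gowersNorm m (0 : Torus d → ℂ) = 0 := by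
  have deltaFun_zero : deltaFun (d := d) m (fun _ => 0) = 0 := by
    induction m with
    | zero => rfl
    | succ m ih =>
      funext p
      exact (congrArg (· * _) (congrFun ih _)).trans (zero_mul _)
  simp [gowersNorm, gowersInner, deltaFun_zero]

theorem rpow_le_gowersNorm_mul {E : ℝ≥0∞} {a b : Torus d → ℂ}
    (h : E ^ 2 ≤ ‖gowersInner (m + 1) fun _ => a‖ₑ * ‖gowersInner (m + 1) fun _ => b‖ₑ) :
    E ^ ((1 : ℝ) / 2 ^ m) ≤ gowersNorm (m + 1) a * gowersNorm (m + 1) b := by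
  calc E ^ ((1 : ℝ) / 2 ^ m) = (E ^ 2) ^ ((1 : ℝ) / 2 ^ (m + 1)) := by
        rw [← ENNReal.rpow_natCast, ← ENNReal.rpow_mul, pow_succ]
        congr 1
        field_simp
        norm_num
    _ ≤ _ := by
        rw [gowersNorm, gowersNorm, ← ENNReal.mul_rpow_of_nonneg _ _ (by positivity)]
        exact ENNReal.rpow_le_rpow h (by positivity)

variable {a b : Torus d → ℂ} (ha : IsBdd a) (hb : IsBdd b)

section
include ha

theorem isBdd_deltaFun_const (m : ℕ) : IsBdd (deltaFun m fun _ => a) :=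
  isBdd_deltaFun m fun _ => ha

theorem enorm_gowersInner_const_succ :
    ‖gowersInner (m + 1) fun _ => a‖ₑ = ∫⁻ u, ‖marg (deltaFun m fun _ => a) u‖ₑ ^ 2 :=
  enorm_integral_cross_self (isBdd_deltaFun_const ha m)

theorem enorm_gowersInner_const_add_two :
    ‖gowersInner (m + 2) fun _ => a‖ₑ = energy (deltaFun m fun _ => a) (deltaFun m fun _ => a) :=
  (enorm_gowersInner_const_succ ha).trans
    (lintegral_marg_cross (isBdd_deltaFun_const ha m) (isBdd_deltaFun_const ha m))

theorem gowersNorm_le_succ (m : ℕ) : gowersNorm m a ≤ gowersNorm (m + 1) a := by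
  have h : ‖gowersInner m fun _ => a‖ₑ ^ 2 ≤ ‖gowersInner (m + 1) fun _ => a‖ₑ := by
    rw [enorm_gowersInner_const_succ ha, gowersInner,
      integral_eq_integral_marg (isBdd_deltaFun_const ha m)]
    simpa using enorm_integral_mul_sq_le (m := volume)
      (isBdd_deltaFun_const ha m).marg.measurable.aemeasurable
      (aemeasurable_const (b := (1 : ℂ)))
  refine (ENNReal.pow_le_pow_left_iff (n := 2 ^ (m + 1)) (by positivity)).mp ?_
  rwa [gowersNorm_pow, pow_succ, pow_mul, gowersNorm_pow]

theorem enorm_coeff_le_gowersNorm (c : Fin d → ℤ) : ∀ m, ‖coeff a c‖ₑ ≤ gowersNorm (m + 2) a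
  | 0 => by
    refine (ENNReal.pow_le_pow_left_iff (n := 2 ^ 2) (by positivity)).mp ?_
    rw [gowersNorm_pow, enorm_gowersInner_const_add_two ha,
      energy_eq_tsum (isBdd_deltaFun_const ha 0) (isBdd_deltaFun_const ha 0)]
    refine le_trans (le_of_eq ?_) (ENNReal.le_tsum c)
    have pcoeff_eq (u : Fin 0 → Torus d) : pcoeff (deltaFun 0 fun _ => a) c u = coeff a c := rfl
    simp only [pcoeff_eq, lintegral_const, measure_univ, mul_one, ← pow_add]
    norm_num
  | m + 1 => (enorm_coeff_le_gowersNorm c m).trans (gowersNorm_le_succ ha _)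

end

/-- The product `a · conj (b(· - v))`. -/
noncomputable def twist (a b : Torus d → ℂ) (v x : Torus d) : ℂ := a x * conj (b (x - v))

theorem deltaFun_twist (v : Torus d) : ∀ (m : ℕ) (f g : (Fin m → Bool) → Torus d → ℂ)
    (x : Torus d) (u : Fin m → Torus d), deltaFun m (fun ι => twist (f ι) (g ι) v) (x, u)
      = cross (deltaFun m f) (deltaFun m g) (x, Fin.snoc u v)
  | 0, f, g, x, u => by rw [cross_snoc]; rfl
  | m + 1, f, g, x, u => by
    have half_twist (i : Bool) : half (fun ι => twist (f ι) (g ι) v) i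
        = fun ι => twist (half f i ι) (half g i ι) v := rfl
    rw [cross_snoc]
    simp only [deltaFun, cross, half_twist]
    rw [deltaFun_twist v m, deltaFun_twist v m, cross_snoc, cross_snoc, sub_right_comm x v]
    simp only [map_mul, Complex.conj_conj]
    ring

theorem marg_deltaFun_twist (v : Torus d) (f g : (Fin m → Bool) → Torus d → ℂ)
    (u : Fin m → Torus d) : marg (deltaFun m fun ι => twist (f ι) (g ι) v) u
      = marg (cross (deltaFun m f) (deltaFun m g)) (Fin.snoc u v) := by
  simp only [marg, deltaFun_twist]

section
include ha hb

theorem IsBdd.twist (v : Torus d) : IsBdd (twist a b v) :=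
  ha.mul (hb.comp (measurable_sub_const v)).star

theorem enorm_gowersInner_twist (v : Torus d) :
    ‖gowersInner (m + 1) fun _ => twist a b v‖ₑ
      = ∫⁻ u, ‖marg (cross (deltaFun m fun _ => a) (deltaFun m fun _ => b))
          (Fin.snoc u v : Fin (m + 1) → Torus d)‖ₑ ^ 2 := by
  simp only [enorm_gowersInner_const_succ (ha.twist hb v), marg_deltaFun_twist]

theorem measurable_enorm_gowersInner_twist :
    Measurable fun v => ‖gowersInner (m + 1) fun _ => twist a b v‖ₑ := by
  have hc := ((isBdd_deltaFun_const ha m).cross (isBdd_deltaFun_const hb m)).marg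
  simp only [enorm_gowersInner_twist ha hb]
  exact Measurable.lintegral_prod_right' (f := fun p : Torus d × (Fin m → Torus d) =>
    ‖marg (cross (deltaFun m fun _ => a) (deltaFun m fun _ => b))
      (Fin.snoc p.2 p.1 : Fin (m + 1) → Torus d)‖ₑ ^ 2)
    ((hc.comp (measurable_snoc measurable_snd measurable_fst)).measurable.enorm.pow_const 2)

theorem lintegral_enorm_gowersInner_twist :
    ∫⁻ v, ‖gowersInner (m + 1) fun _ => twist a b v‖ₑ
      = energy (deltaFun m fun _ => a) (deltaFun m fun _ => b) := by
  have hA := isBdd_deltaFun_const ha m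
  have hB := isBdd_deltaFun_const hb m
  have hc := (hA.cross hB).marg.measurable.enorm.pow_const 2
  rw [← lintegral_marg_cross hA hB, lintegral_snoc hc, lintegral_lintegral_swap
    (f := fun u v => ‖marg (cross (deltaFun m fun _ => a) (deltaFun m fun _ => b))
      (Fin.snoc u v : Fin (m + 1) → Torus d)‖ₑ ^ 2)
    (hc.comp (measurable_snoc measurable_fst measurable_snd)).aemeasurable]
  simp only [enorm_gowersInner_twist ha hb]

theorem lintegral_enorm_gowersInner_twist_rpow_le :
    (∫⁻ v, ‖gowersInner (m + 1) fun _ => twist a b v‖ₑ) ^ ((1 : ℝ) / 2 ^ (m + 1))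
      ≤ gowersNorm (m + 2) a * gowersNorm (m + 2) b := by
  apply rpow_le_gowersNorm_mul
  rw [lintegral_enorm_gowersInner_twist ha hb, enorm_gowersInner_const_add_two ha,
    enorm_gowersInner_const_add_two hb]
  exact energy_sq_le (isBdd_deltaFun_const ha m) (isBdd_deltaFun_const hb m)

end

theorem gowersInner_succ_eq_integral {f : (Fin (m + 1) → Bool) → Torus d → ℂ}
    (hf : ∀ ι, IsBdd (f ι)) :
    gowersInner (m + 1) f
      = ∫ v, gowersInner m fun ι => twist (half f false ι) (half f true ι) v := by
  have hc := isBdd_deltaFun (m + 1) hf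
  rw [gowersInner, integral_eq_integral_marg hc, integral_snoc hc.marg,
    (hc.marg.comp (measurable_snoc measurable_fst measurable_snd)).integral_integral_swap
      (F := fun (u : Fin m → Torus d) v => marg (deltaFun (m + 1) f) (Fin.snoc u v))]
  refine integral_congr_ae (Eventually.of_forall fun v => ?_)
  have ht : IsBdd (deltaFun m fun ι => twist (half f false ι) (half f true ι) v) :=
    isBdd_deltaFun m fun ι => (hf _).twist (hf _) v
  simp only [gowersInner, integral_eq_integral_marg ht, marg_deltaFun_twist, deltaFun]

theorem enorm_gowersInner_one_le {f : (Fin 1 → Bool) → Torus d → ℂ} (hf : ∀ ι, IsBdd (f ι)) :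
    ‖gowersInner 1 f‖ₑ ≤ ∏ ι, gowersNorm 1 (f ι) := by
  have half_eq (i : Bool) : half f i = fun _ => f (Fin.snoc default i) :=
    funext fun ι => by rw [half, Subsingleton.elim ι default]
  have h := rpow_le_gowersNorm_mul (m := 0) (E := ‖gowersInner 1 f‖ₑ)
    (a := f (Fin.snoc default false)) (b := f (Fin.snoc default true)) <| by
      rw [enorm_gowersInner_const_succ (hf _), enorm_gowersInner_const_succ (hf _), gowersInner,
        show deltaFun 1 f = cross _ _ from rfl, half_eq, half_eq]
      exact enorm_integral_cross_sq_le (isBdd_deltaFun_const (hf _) 0)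
        (isBdd_deltaFun_const (hf _) 0)
  rw [prod_snoc, Fintype.prod_unique, Fintype.prod_unique]
  rwa [pow_zero, div_one, ENNReal.rpow_one] at h

theorem enorm_gowersInner_le_prod_gowersNorm : ∀ (m : ℕ)
    {f : (Fin (m + 1) → Bool) → Torus d → ℂ}, (∀ ι, IsBdd (f ι)) →
    ‖gowersInner (m + 1) f‖ₑ ≤ ∏ ι, gowersNorm (m + 1) (f ι)
  | 0, _, hf => enorm_gowersInner_one_le hf
  | m + 1, f, hf => by
    let t (v : Torus d) (ι : Fin (m + 1) → Bool) := twist (half f false ι) (half f true ι) v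
    have weights : ∑ _ι : Fin (m + 1) → Bool, (1 : ℝ) / 2 ^ (m + 1) = 1 := by simp
    calc ‖gowersInner (m + 2) f‖ₑ ≤ ∫⁻ v, ‖gowersInner (m + 1) (t v)‖ₑ := by
          rw [gowersInner_succ_eq_integral hf]
          exact enorm_integral_le_lintegral_enorm _
      _ ≤ ∫⁻ v, ∏ ι, ‖gowersInner (m + 1) fun _ => t v ι‖ₑ ^ ((1 : ℝ) / 2 ^ (m + 1)) :=
          lintegral_mono fun v =>
            enorm_gowersInner_le_prod_gowersNorm m fun ι => (hf _).twist (hf _) v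
      _ ≤ ∏ ι, (∫⁻ v, ‖gowersInner (m + 1) fun _ => t v ι‖ₑ) ^ ((1 : ℝ) / 2 ^ (m + 1)) :=
          ENNReal.lintegral_prod_norm_pow_le _ (fun ι _ =>
            (measurable_enorm_gowersInner_twist (hf _) (hf _)).aemeasurable) weights
            fun _ _ => by positivity
      _ ≤ ∏ ι, gowersNorm (m + 2) (half f false ι) * gowersNorm (m + 2) (half f true ι) :=
          Finset.prod_le_prod' fun ι _ =>
            lintegral_enorm_gowersInner_twist_rpow_le (hf _) (hf _)
      _ = ∏ ι, gowersNorm (m + 2) (f ι) := by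
          rw [prod_snoc (m := m + 1), Finset.prod_mul_distrib]
          rfl

/-- The family `f`, repeated four times, is a family for `Δ^{m+2}`, to which the
Gowers–Cauchy–Schwarz inequality applies. -/
theorem energy_deltaFun_self_le {f : (Fin m → Bool) → Torus d → ℂ} (hf : ∀ ι, IsBdd (f ι)) :
    energy (deltaFun m f) (deltaFun m f) ≤ (∏ ι, gowersNorm (m + 2) (f ι)) ^ 4 := by
  let g : (Fin (m + 1) → Bool) → Torus d → ℂ := fun ι => f (Fin.init ι)
  let h : (Fin (m + 2) → Bool) → Torus d → ℂ := fun ι => g (Fin.init ι)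
  have half_g (i : Bool) : half g i = f := funext fun ι => by simp [half, g]
  have half_h (i : Bool) : half h i = g := funext fun ι => by simp [half, h]
  have hΔ := isBdd_deltaFun m hf
  have hg : deltaFun (m + 1) g = cross (deltaFun m f) (deltaFun m f) := by
    rw [deltaFun, half_g, half_g]
  calc energy (deltaFun m f) (deltaFun m f) = ‖gowersInner (m + 2) h‖ₑ := by
        rw [gowersInner, deltaFun, half_h, half_h, hg, enorm_integral_cross_self (hΔ.cross hΔ),
          lintegral_marg_cross hΔ hΔ]
    _ ≤ ∏ ι, gowersNorm (m + 2) (h ι) :=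
        enorm_gowersInner_le_prod_gowersNorm (m + 1) fun _ => hf _
    _ = (∏ ι, gowersNorm (m + 2) (f ι)) ^ 4 := by
        simp only [prod_snoc, h, g, Fin.init_snoc]
        ring

end Gowers

section FourierBound

variable {f : (Fin (m + 1) → Bool) → Torus d → ℂ} (hf : ∀ ι, IsBdd (f ι))
include hf

theorem tsum_enorm_integral_cubeChar_mul_cross_sq_le {A B : Cube d m → ℂ} (hA : IsBdd A)
    (hB : IsBdd B) {a b : ℝ≥0∞}
    (ha : energy A A ≤ a ^ 2 * energy (deltaFun m (half f false)) (deltaFun m (half f false)))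
    (hb : energy B B ≤ b ^ 2 * energy (deltaFun m (half f true)) (deltaFun m (half f true))) :
    ∑' η, ‖∫ p, cubeChar (-0) (-η) p * cross A B p‖ₑ ^ 2
      ≤ a * b * ∏ ι, gowersNorm (m + 2) (f ι) ^ 2 := by
  let P (i : Bool) := ∏ ι, gowersNorm (m + 2) (half f i ι)
  have energy_le (i : Bool) :
      energy (deltaFun m (half f i)) (deltaFun m (half f i)) ≤ P i ^ 4 :=
    energy_deltaFun_self_le fun _ => hf _
  have energy_cross_le : energy A B ≤ a * b * (P false * P true) ^ 2 := by
    refine (ENNReal.pow_le_pow_left_iff two_ne_zero).mp ?_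
    calc energy A B ^ 2 ≤ energy A A * energy B B := energy_sq_le hA hB
      _ ≤ (a ^ 2 * P false ^ 4) * (b ^ 2 * P true ^ 4) :=
          mul_le_mul' (ha.trans (mul_le_mul_right (energy_le _) _))
            (hb.trans (mul_le_mul_right (energy_le _) _))
      _ = (a * b * (P false * P true) ^ 2) ^ 2 := by ring
  refine (tsum_enorm_integral_cubeChar_mul_sq_le (hA.cross hB)).trans ?_
  rw [lintegral_marg_cross hA hB, Finset.prod_pow, prod_snoc]
  exact energy_cross_le

variable {φ : C(Torus d, ℝ)} (hφ : ∀ x, 0 ≤ φ x) (hφ1 : ∫ x, φ x = 1)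
  (hφc : ∀ c, ‖1 - kernelCoeff φ c‖ ≤ 1) (j : Fin (m + 1))
include hφ hφ1 hφc

theorem tsum_enorm_integral_cubeChar_mul_deltaFunHighBoth_sq_le :
    ∑' η, ‖∫ p, cubeChar (-0) (-η) p * deltaFunHighBoth φ j f p‖ₑ ^ 2
      ≤ 4 * ∏ ι, gowersNorm (m + 2) (f ι) ^ 2 := by
  have hΔ (i : Bool) : IsBdd (deltaFun m (half f i)) := isBdd_deltaFun m fun _ => hf _
  have high (i : Bool) := energy_highPass_le hφ hφ1 hφc (hΔ i) j
  have four : (4 : ℝ≥0∞) = 2 ^ 2 := by norm_num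
  rw [four] at high
  exact (tsum_enorm_integral_cubeChar_mul_cross_sq_le hf ((hΔ _).highPass hφ hφ1 j)
    ((hΔ _).highPass hφ hφ1 j) (high _) (high _)).trans_eq (by rw [four, sq 2])

theorem tsum_enorm_integral_cubeChar_mul_deltaFunHighRight_sq_le :
    ∑' η, ‖∫ p, cubeChar (-0) (-η) p * deltaFunHighRight φ j f p‖ₑ ^ 2
      ≤ 2 * ∏ ι, gowersNorm (m + 2) (f ι) ^ 2 := by
  have hΔ (i : Bool) : IsBdd (deltaFun m (half f i)) := isBdd_deltaFun m fun _ => hf _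
  have high := energy_highPass_le hφ hφ1 hφc (hΔ true) j
  rw [show (4 : ℝ≥0∞) = 2 ^ 2 by norm_num] at high
  simpa only [one_mul, deltaFunHighRight] using
    tsum_enorm_integral_cubeChar_mul_cross_sq_le hf (hΔ _) ((hΔ _).highPass hφ hφ1 j)
      (a := 1) (by rw [one_pow, one_mul]) high

end FourierBound

section ComplexMeasure

theorem cintegral_one {X : Type*} [MeasurableSpace X] (μ : ComplexMeasure X) :
    cintegral μ (fun _ => 1) = μ Set.univ := by
  simp [cintegral]

theorem cintegral_zero_measure {X : Type*} [MeasurableSpace X] (f : X → ℂ) :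
    cintegral 0 f = 0 :=
  VectorMeasure.integral_zero_vectorMeasure ..

theorem cintegral_const_mul {X : Type*} [MeasurableSpace X] (μ : ComplexMeasure X) (c : ℂ)
    (f : X → ℂ) : cintegral μ (fun x => c * f x) = c * cintegral μ f := by
  refine setToFun_smul (𝕜 := ℂ) _ (fun c s x => ?_) c f
  change ContinuousLinearMap.mul ℝ ℂ (c • x) (μ s) = c • ContinuousLinearMap.mul ℝ ℂ x (μ s)
  simp only [smul_eq_mul, ContinuousLinearMap.mul_apply', mul_assoc]

theorem norm_cintegral_le {X : Type*} [MeasurableSpace X] (μ : ComplexMeasure X) {f : X → ℂ}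
    {C : ℝ} (hC : ∀ x, ‖f x‖ ≤ C) : ‖cintegral μ f‖ ≤ μ.variation.real Set.univ * C :=
  calc ‖cintegral μ f‖ ≤ ‖ContinuousLinearMap.mul ℝ ℂ‖ * ∫ x, ‖f x‖ ∂μ.variation :=
        VectorMeasure.norm_integral_le_integral_norm
    _ ≤ 1 * (μ.variation.real Set.univ * C) := by
        gcongr
        · exact ContinuousLinearMap.opNorm_mul_le ℝ ℂ
        · exact (integral_mono_of_nonneg (.of_forall fun _ => norm_nonneg _) (integrable_const C)
            (.of_forall hC)).trans_eq (by simp)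
    _ = _ := one_mul _

/-- Integration against a complex measure, as a continuous linear functional on `C(X, ℂ)`. -/
noncomputable def cintegralCLM {X : Type*} [TopologicalSpace X] [CompactSpace X]
    [MeasurableSpace X] [BorelSpace X] (μ : ComplexMeasure X) : C(X, ℂ) →L[ℂ] ℂ :=
  LinearMap.mkContinuous
    { toFun := fun f => cintegral μ f
      map_add' := fun f g => VectorMeasure.integral_add
        ((IsBdd.of_continuous f.continuous).integrable _)
        ((IsBdd.of_continuous g.continuous).integrable _)
      map_smul' := fun c f => cintegral_const_mul μ c f }
    (μ.variation.real Set.univ) fun f => norm_cintegral_le μ f.norm_coe_le_norm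

end ComplexMeasure

section Mollify

open UnitAddTorus

variable (K : C(Torus d, ℝ)) (μ : ComplexMeasure (Torus d))

/-- The translates `x ↦ K (x - ·)`. -/
noncomputable def translates (K : C(Torus d, ℝ)) : C(Torus d, C(Torus d, ℂ)) :=
  ContinuousMap.curry ⟨fun p : Torus d × Torus d => (K (p.1 - p.2) : ℂ), by fun_prop⟩

theorem mollify_apply (x : Torus d) : mollify K μ x = cintegralCLM μ (translates K x) := rfl

theorem continuous_mollify : Continuous (mollify K μ) :=
  ((cintegralCLM μ).continuous.comp (translates K).continuous).congr
    fun x => (mollify_apply K μ x).symm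

theorem isBdd_mollify : IsBdd (mollify K μ) := .of_continuous (continuous_mollify K μ)

/-- Fourier coefficients of a complex measure on the torus. -/
noncomputable def measureCoeff (μ : ComplexMeasure (Torus d)) (ξ : Fin d → ℤ) : ℂ :=
  cintegral μ (mFourier (-ξ))

theorem integral_mFourier_mul_translate (ξ : Fin d → ℤ) (y : Torus d) :
    ∫ x, mFourier (-ξ) x * (K (x - y) : ℂ) = kernelCoeff K ξ * mFourier (-ξ) y :=
  calc ∫ x, mFourier (-ξ) x * (K (x - y) : ℂ)
      = ∫ x, mFourier (-ξ) (x - y + y) * (K (x - y) : ℂ) := by simp only [sub_add_cancel]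
    _ = ∫ x, mFourier (-ξ) (x + y) * (K x : ℂ) :=
        integral_sub_right_eq_self (fun x => mFourier (-ξ) (x + y) * (K x : ℂ)) y
    _ = kernelCoeff K ξ * mFourier (-ξ) y := by
        simp only [mFourier_add_apply, mul_right_comm _ (mFourier (-ξ) y), integral_mul_const,
          kernelCoeff]

theorem coeff_mollify (ξ : Fin d → ℤ) :
    coeff (mollify K μ) ξ = kernelCoeff K ξ * measureCoeff μ ξ := by
  let F (x : Torus d) : C(Torus d, ℂ) := mFourier (-ξ) x • translates K x
  have hF : Integrable F :=
    ((mFourier (-ξ)).continuous.smul (translates K).continuous).integrable_of_hasCompactSupport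
      (.of_compactSpace _)
  have integral_F : ∫ x, F x = kernelCoeff K ξ • mFourier (-ξ) := by
    ext y
    rw [ContinuousMap.integral_apply hF]
    exact integral_mFourier_mul_translate K ξ y
  calc coeff (mollify K μ) ξ = ∫ x, cintegralCLM μ (F x) := by
        simp only [F, coeff, mollify_apply, map_smul, smul_eq_mul]
    _ = cintegralCLM μ (kernelCoeff K ξ • mFourier (-ξ)) := by
        rw [(cintegralCLM μ).integral_comp_comm hF, integral_F]
    _ = kernelCoeff K ξ * measureCoeff μ ξ := map_smul _ _ _

theorem mollify_eq_zero {μ : ComplexMeasure (Torus d)} (hμ : ∀ ξ, measureCoeff μ ξ = 0) :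
    mollify K μ = 0 := by
  have hcoeff (ξ : Fin d → ℤ) : mFourierCoeff (⟨_, continuous_mollify K μ⟩ : C(_, ℂ)) ξ = 0 := by
    rw [mFourierCoeff_eq_coeff]
    exact (coeff_mollify K μ ξ).trans (by rw [hμ, mul_zero])
  funext x
  have hsum := hasSum_mFourier_series_apply_of_summable
    (summable_zero.congr fun ξ => (hcoeff ξ).symm) x
  simp only [hcoeff, zero_smul] at hsum
  exact hsum.unique hasSum_zero

end Mollify

theorem isWeakValue_weakValue {G : ((Fin m → Bool) → Torus d → ℂ) → Cube d m → ℂ}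
    {μ : (Fin m → Bool) → ComplexMeasure (Torus d)} (h : ∃ D, IsWeakValue G μ D) :
    IsWeakValue G μ (weakValue G μ) := by
  rw [weakValue, dif_pos h]
  exact h.choose_spec

section ApproxIdentity

open UnitAddTorus

variable {K : ℕ → C(Torus d, ℝ)} (hK : IsApproxIdentity K)

theorem integrable_kernel (φ : C(Torus d, ℝ)) : Integrable φ :=
  φ.continuous.integrable_of_hasCompactSupport (.of_compactSpace _)

include hK

theorem IsApproxIdentity.norm_integral_mul_le {f : Torus d → ℂ} {ε C : ℝ} (hε : 0 ≤ ε)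
    (hC : ∀ x, ‖f x‖ ≤ C) {U : Set (Torus d)} (hU : MeasurableSet U) (hfU : ∀ x ∈ U, ‖f x‖ ≤ ε)
    (n : ℕ) : ‖∫ x, f x * (K n x : ℂ)‖ ≤ ε + C * ∫ x in Uᶜ, K n x := by
  have hint := integrable_kernel (K n)
  have hint' := hint.indicator hU.compl
  have bound (x : Torus d) :
      ‖f x * (K n x : ℂ)‖ ≤ ε * K n x + C * Uᶜ.indicator (K n) x := by
    have hx := hK.nonneg n x
    rw [norm_mul, Complex.norm_real, Real.norm_of_nonneg hx]
    by_cases hxU : x ∈ U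
    · rw [Set.indicator_of_notMem (by simpa using hxU), mul_zero, add_zero]
      exact mul_le_mul_of_nonneg_right (hfU x hxU) hx
    · rw [Set.indicator_of_mem (by simpa using hxU)]
      nlinarith [hC x, mul_nonneg hε hx]
  calc ‖∫ x, f x * (K n x : ℂ)‖ ≤ ∫ x, (ε * K n x + C * Uᶜ.indicator (K n) x) :=
        norm_integral_le_of_norm_le ((hint.const_mul _).add (hint'.const_mul _)) (.of_forall bound)
    _ = ε + C * ∫ x in Uᶜ, K n x := by
        rw [integral_add (hint.const_mul _) (hint'.const_mul _), integral_const_mul,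
          integral_const_mul, hK.integral_eq_one, integral_indicator hU.compl, mul_one]

theorem IsApproxIdentity.tendsto_integral_mul_zero {f : C(Torus d, ℂ)} (hf : f 0 = 0) :
    Tendsto (fun n => ∫ x, f x * (K n x : ℂ)) atTop (𝓝 0) := by
  rw [Metric.tendsto_nhds]
  intro ε hε
  have hUo : IsOpen {x | ‖f x‖ < ε / 2} := isOpen_lt (by fun_prop) continuous_const
  have hU : {x | ‖f x‖ < ε / 2} ∈ 𝓝 (0 : Torus d) := hUo.mem_nhds (by simpa [hf] using hε)
  have htail := (hK.concentrates _ hU).const_mul ‖f‖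
  rw [mul_zero] at htail
  filter_upwards [htail.eventually_lt_const (half_pos hε)] with n hn
  have := hK.norm_integral_mul_le (half_pos hε).le f.norm_coe_le_norm hUo.measurableSet
    (fun x hx => le_of_lt hx) n
  rw [dist_zero_right]
  linarith

theorem IsApproxIdentity.tendsto_integral_mul (f : C(Torus d, ℂ)) :
    Tendsto (fun n => ∫ x, f x * (K n x : ℂ)) atTop (𝓝 (f 0)) := by
  have integral_sub_const (n : ℕ) :
      ∫ x, (f x - f 0) * (K n x : ℂ) = (∫ x, f x * (K n x : ℂ)) - f 0 := by
    have hbdd : IsBdd fun x => (K n x : ℂ) := .of_continuous (by fun_prop)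
    simp only [sub_mul]
    rw [integral_sub (((IsBdd.of_continuous f.continuous).mul hbdd).integrable _)
      ((hbdd.integrable _).const_mul _), integral_const_mul, integral_complex_ofReal,
      hK.integral_eq_one, Complex.ofReal_one, mul_one]
  have h := hK.tendsto_integral_mul_zero (f := f - .const _ (f 0)) (by simp)
  simp only [ContinuousMap.sub_apply, ContinuousMap.const_apply, integral_sub_const] at h
  exact tendsto_sub_nhds_zero_iff.mp h

theorem IsApproxIdentity.tendsto_kernelCoeff (ξ : Fin d → ℤ) :
    Tendsto (fun n => kernelCoeff (K n) ξ) atTop (𝓝 1) := by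
  have mFourier_apply_zero : mFourier (-ξ) (0 : Torus d) = 1 := by simp [mFourier]
  exact mFourier_apply_zero ▸ hK.tendsto_integral_mul (mFourier (-ξ))

variable {μ : ComplexMeasure (Torus d)}

theorem IsApproxIdentity.tendsto_coeff_mollify (μ : ComplexMeasure (Torus d)) (ξ : Fin d → ℤ) :
    Tendsto (fun n => coeff (mollify (K n) μ) ξ) atTop (𝓝 (measureCoeff μ ξ)) := by
  simp only [coeff_mollify]
  simpa only [one_mul] using (hK.tendsto_kernelCoeff ξ).mul_const (measureCoeff μ ξ)

theorem IsApproxIdentity.tendsto_gowersNorm_mollify (hμ : uNorm m μ ≠ ∞) :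
    Tendsto (fun n => gowersNorm m (mollify (K n) μ)) atTop (𝓝 (uNorm m μ)) := by
  have hex : ∃ D, IsWeakValue (deltaFun m) (fun _ => μ) D := by
    by_contra h
    exact hμ (if_neg h)
  have htotal : Tendsto (fun n => gowersInner m fun _ => mollify (K n) μ) atTop
      (𝓝 (weakValue (deltaFun m) (fun _ => μ) Set.univ)) := by
    simpa only [ContinuousMap.one_apply, one_mul, gowersInner, Pi.one_def, ContinuousMap.coe_one,
      cintegral_one] using isWeakValue_weakValue hex K hK 1
  rw [uNorm, if_pos hex]
  exact (ENNReal.continuous_rpow_const.tendsto _).comp htotal.enorm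

theorem IsApproxIdentity.enorm_measureCoeff_le_uNorm (ξ : Fin d → ℤ) :
    ‖measureCoeff μ ξ‖ₑ ≤ uNorm (m + 2) μ := by
  rcases eq_or_ne (uNorm (m + 2) μ) ∞ with htop | hfin
  · exact htop ▸ le_top
  · exact le_of_tendsto_of_tendsto' (hK.tendsto_coeff_mollify μ ξ).enorm
      (hK.tendsto_gowersNorm_mollify hfin)
      fun n => enorm_coeff_le_gowersNorm (isBdd_mollify (K n) μ) ξ m

theorem IsApproxIdentity.mollify_eq_zero_of_uNorm_eq_zero (hμ : uNorm (m + 2) μ = 0)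
    (φ : C(Torus d, ℝ)) : mollify φ μ = 0 :=
  mollify_eq_zero φ fun ξ => enorm_eq_zero.mp <|
    nonpos_iff_eq_zero.mp ((hK.enorm_measureCoeff_le_uNorm ξ).trans_eq hμ)

end ApproxIdentity

section WeakLimit

variable {k : ℕ} {K : ℕ → C(Torus d, ℝ)} {μ : (Fin k → Bool) → ComplexMeasure (Torus d)}

theorem IsWeakValue.tendsto_integral_cubeChar_mul
    {G : ((Fin k → Bool) → Torus d → ℂ) → Cube d k → ℂ} {D : ComplexMeasure (Cube d k)}
    (hD : IsWeakValue G μ D) (hK : IsApproxIdentity K) (ξ : Fin d → ℤ) (η : Fin k → Fin d → ℤ) :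
    Tendsto (fun n => ∫ p, cubeChar (-ξ) (-η) p * G (fun ι => mollify (K n) (μ ι)) p) atTop
      (𝓝 (fourierCoeffMeasure D ξ η)) := by
  rw [fourierCoeffMeasure_eq_cintegral_cubeChar]
  exact hD K hK (cubeChar (-ξ) (-η))

theorem IsWeakValue.tsum_enorm_fourierCoeffMeasure_sq_le_of_tendsto
    {G : ((Fin k → Bool) → Torus d → ℂ) → Cube d k → ℂ} {D : ComplexMeasure (Cube d k)}
    (hD : IsWeakValue G μ D) (hK : IsApproxIdentity K) (ξ : Fin d → ℤ) {R : ℕ → ℝ≥0∞} {r : ℝ≥0∞}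
    (hG : ∀ n, ∑' η, ‖∫ p, cubeChar (-ξ) (-η) p * G (fun ι => mollify (K n) (μ ι)) p‖ₑ ^ 2 ≤ R n)
    (hR : Tendsto R atTop (𝓝 r)) :
    ∑' η, ‖fourierCoeffMeasure D ξ η‖ₑ ^ 2 ≤ r := by
  rw [ENNReal.tsum_eq_iSup_sum]
  exact iSup_le fun s => le_of_tendsto_of_tendsto'
    (tendsto_finsetSum s fun η _ =>
      ENNReal.Tendsto.pow (hD.tendsto_integral_cubeChar_mul hK ξ η).enorm) hR
    fun n => (ENNReal.sum_le_tsum s).trans (hG n)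

theorem IsApproxIdentity.tendsto_prod_gowersNorm_mollify (hK : IsApproxIdentity K)
    (hμ : ∀ ι, uNorm m (μ ι) ≠ ∞) :
    Tendsto (fun n => ∏ ι, gowersNorm m (mollify (K n) (μ ι)) ^ 2) atTop
      (𝓝 (∏ ι, uNorm m (μ ι) ^ 2)) :=
  ENNReal.tendsto_finsetProd_of_ne_top _
    (fun ι _ => ENNReal.Tendsto.pow (hK.tendsto_gowersNorm_mollify (hμ ι)))
    fun ι _ => ENNReal.pow_ne_top (hμ ι)

theorem IsApproxIdentity.prod_gowersNorm_mollify_eq_zero (hK : IsApproxIdentity K)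
    {ι₀ : Fin k → Bool} (hι₀ : uNorm (m + 2) (μ ι₀) = 0) (φ : C(Torus d, ℝ)) :
    ∏ ι, gowersNorm (m + 2) (mollify φ (μ ι)) ^ 2 = 0 := by
  refine Finset.prod_eq_zero (Finset.mem_univ ι₀) ?_
  rw [hK.mollify_eq_zero_of_uNorm_eq_zero hι₀, gowersNorm_zero, zero_pow two_ne_zero]

theorem tsum_enorm_fourierCoeffMeasure_weakValue_sq_le (hK : IsApproxIdentity K)
    {G : ((Fin k → Bool) → Torus d → ℂ) → Cube d k → ℂ} (ξ : Fin d → ℤ) {C : ℝ≥0∞} (hC : C ≠ 0)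
    (hG : ∀ f : (Fin k → Bool) → Torus d → ℂ, (∀ ι, IsBdd (f ι)) →
      ∑' η, ‖∫ p, cubeChar (-ξ) (-η) p * G f p‖ₑ ^ 2
        ≤ C * ∏ ι, gowersNorm (m + 2) (f ι) ^ 2)
    (μ : (Fin k → Bool) → ComplexMeasure (Torus d)) :
    ∑' η, ‖fourierCoeffMeasure (weakValue G μ) ξ η‖ₑ ^ 2
      ≤ C * ∏ ι, uNorm (m + 2) (μ ι) ^ 2 := by
  by_cases hex : ∃ D, IsWeakValue G μ D
  swap
  · simp [weakValue, dif_neg hex, fourierCoeffMeasure, cintegral_zero_measure]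
  have le_of_tendsto {r : ℝ≥0∞} :=
    (isWeakValue_weakValue hex).tsum_enorm_fourierCoeffMeasure_sq_le_of_tendsto hK ξ (r := r)
      fun n => hG _ fun ι => isBdd_mollify (K n) (μ ι)
  by_cases hzero : ∃ ι, uNorm (m + 2) (μ ι) = 0
  · obtain ⟨ι₀, hι₀⟩ := hzero
    refine (le_of_tendsto ?_).trans zero_le
    simp only [hK.prod_gowersNorm_mollify_eq_zero hι₀, mul_zero, tendsto_const_nhds]
  have sq_ne_zero (ι : Fin k → Bool) : uNorm (m + 2) (μ ι) ^ 2 ≠ 0 :=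
    pow_ne_zero 2 fun h => hzero ⟨ι, h⟩
  by_cases htop : ∃ ι, uNorm (m + 2) (μ ι) = ∞
  · obtain ⟨ι₁, hι₁⟩ := htop
    have prod_eq_top : ∏ ι, uNorm (m + 2) (μ ι) ^ 2 = ∞ :=
      WithTop.prod_eq_top (Finset.mem_univ ι₁) (by rw [hι₁, ENNReal.top_pow two_ne_zero]; rfl)
        fun ι _ => sq_ne_zero ι
    exact le_top.trans_eq (by rw [prod_eq_top, ENNReal.mul_top hC])
  · exact le_of_tendsto <| ENNReal.Tendsto.const_mul
      (hK.tendsto_prod_gowersNorm_mollify (not_exists.mp htop))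
      (.inl (Finset.prod_ne_zero_iff.mpr fun ι _ => sq_ne_zero ι))

end WeakLimit

theorem IsFrequencyCutoff.norm_one_sub_kernelCoeff_le {φ : ℕ → C(Torus d, ℝ)}
    (hφ : IsFrequencyCutoff φ) (n : ℕ) (c : Fin d → ℤ) : ‖1 - kernelCoeff (φ n) c‖ ≤ 1 := by
  obtain ⟨r, ⟨hr0, hr1⟩, hr⟩ := hφ.coeff_mem n c
  rw [hr, ← Complex.ofReal_one, ← Complex.ofReal_sub, Complex.norm_real, Real.norm_eq_abs,
    abs_of_nonneg (sub_nonneg.mpr hr1)]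
  exact sub_le_self 1 hr0

end GowersSingular

open GowersSingular in
theorem mainTheorem7_general {d k : ℕ} {φ : ℕ → C(Torus d, ℝ)} (hφ : IsApproxIdentity φ) {N : ℕ}
    (hN : ∀ c, ‖1 - kernelCoeff (φ N) c‖ ≤ 1) (j : Fin (k + 1))
    (μ : (Fin (k + 1) → Bool) → ComplexMeasure (Torus d)) :
    (∑' η, ‖fourierCoeffMeasure (deltaHighBoth (φ N) j μ) 0 η‖ₑ ^ 2
      ≤ 4 * ∏ ι, uNorm (k + 2) (μ ι) ^ 2) ∧
    (∑' η, ‖fourierCoeffMeasure (deltaHighRight (φ N) j μ) 0 η‖ₑ ^ 2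
      ≤ 2 * ∏ ι, uNorm (k + 2) (μ ι) ^ 2) :=
  ⟨tsum_enorm_fourierCoeffMeasure_weakValue_sq_le hφ 0 four_ne_zero
      (fun _ hf => tsum_enorm_integral_cubeChar_mul_deltaFunHighBoth_sq_le hf (hφ.nonneg N)
        (hφ.integral_eq_one N) hN j) μ,
    tsum_enorm_fourierCoeffMeasure_weakValue_sq_le hφ 0 two_ne_zero
      (fun _ hf => tsum_enorm_integral_cubeChar_mul_deltaFunHighRight_sq_le hf (hφ.nonneg N)
        (hφ.integral_eq_one N) hN j) μ⟩

theorem mainTheorem7 {d k : ℕ} (φ : ℕ → C(GowersSingular.Torus d, ℝ))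
    (hφ : GowersSingular.IsFrequencyCutoff φ) (N : ℕ) (j : Fin (k + 1))
    (μ : (Fin (k + 1) → Bool) → ComplexMeasure (GowersSingular.Torus d))
    (hμ : ∀ ι, GowersSingular.MemU (k + 1) (μ ι)) :
    (∑' η : Fin (k + 1) → Fin d → ℤ,
        ‖GowersSingular.fourierCoeffMeasure
          (GowersSingular.deltaHighBoth (φ N) j μ) 0 η‖ₑ ^ 2
      ≤ 16 * ∏ ι, GowersSingular.uNorm (k + 2) (μ ι) ^ 2) ∧
    (∑' η : Fin (k + 1) → Fin d → ℤ,
        ‖GowersSingular.fourierCoeffMeasure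
          (GowersSingular.deltaHighRight (φ N) j μ) 0 η‖ₑ ^ 2
      ≤ 2 * ∏ ι, GowersSingular.uNorm (k + 2) (μ ι) ^ 2) :=
  (mainTheorem7_general hφ.toIsApproxIdentity (hφ.norm_one_sub_kernelCoeff_le N) j
    μ).imp_left fun h => h.trans (by gcongr; norm_num)
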